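/- Let $s\ge 1$ and $k\ge 0$ be integers. Then there are constants $c_s>0$, depending only on $s$, and $C_{k,s}>0$, depending only on $k$ and $s$, such that the following holds. Let $p$ be a prime and let $d\ge (k+s+2)(k+s+1)+1$. Let $M(n)=(nA)\cdot n$ be a non-degenerate homogeneous quadratic form on $\mathbb F_p^d$ (so $A$ is a symmetric $d\times d$ matrix over $\mathbb F_p$ with $\det A\ne 0$), let $r\in\mathbb F_p$, and put $V(M-r)=\{n\in\mathbb F_p^d: M(n)=r\}$. Let $X=\{v_0,\dots,v_{k+s-1}\}\subseteq\mathbb F_p^d$ consist of $k+s$ distinct points, with $\dim\operatorname{span}_{\mathbb F_p}(X-X)=k$, and suppose that $X$ is $M$-spherical: there are $z\in\mathbb F_p^d$ and $\rho\in\mathbb F_p$ with $M(v_j-z)=\rho$ for all $j$. Let $I\subseteq\{0,\dots,k+s-1\}$ be any generating set of $X$, i.e. for some $i_0\in I$ the vectors $v_i-v_{i_0}$, $i\in I\setminus\{i_0\}$, form a basis of $\operatorname{span}_{\mathbb F_p}(X-X)$. Let $b_{i,j}\in\mathbb F_p$ ($i\in I$, $0\le j\le k+s-1$) be the unique constants with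 $\sum_{i\in I}b_{i,j}=1$ and $v_j=\sum_{i\in I}b_{i,j}v_i$ for all $j$. Let $\Omega$ be the set of almost $M$-congruent copies of $X$ in $V(M-r)$, that is, the set of all tuples $(x_0,\dots,x_{k+s-1})\in(\mathbb F_p^d)^{k+s}$ such that $M(x_i)=r$ and $M(x_i-x_{i'})=M(v_i-v_{i'})$ for all $i,i'\in I$, and $x_j=\sum_{i\in I}b_{i,j}x_i$ for all $j$. Then for all functions $f_0,\dots,f_{k+s-1}$ with $|f_j|\le 1$ on $V(M-r)$, $$\Bigl|\mathbb E_{(x_0,\dots,x_{k+s-1})\in\Omega}\,f_0(x_0)f_1(x_1)\cdots f_{k+s-1}(x_{k+s-1})\Bigr|\le \|f_0\|_{U^s(V(M-r))}+C_{k,s}\,p^{-c_s}.$$ Here $\mathbb E_{x\in S}$ is the average over the finite set $S$ (taken to be $0$ if $S=\emptyset$), and $$\|f\|_{U^s(V(M-r))}=\Bigl|\mathbb E_{(n,h_1,\dots,h_s)\in\Box_s(V(M-r))}\prod_{\epsilon\in\{0,1\}^s}\mathcal C^{|\epsilon|}f(n+\epsilon_1h_1+\dots+\epsilon_sh_s)\Bigr|^{1/2^s},$$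 where $\mathcal C$ is complex conjugation, $|\epsilon|=\epsilon_1+\dots+\epsilon_s$, and $\Box_s(V(M-r))$ is the set of $(n,h_1,\dots,h_s)\in(\mathbb F_p^d)^{s+1}$ with $n+\epsilon_1h_1+\dots+\epsilon_sh_s\in V(M-r)$ for all $\epsilon\in\{0,1\}^s$. -/

import Mathlib

open scoped BigOperators Matrix

namespace SphericalGowers

/-- The homogeneous quadratic form `M(n) = (nA) · n` on `𝔽_p^d` associated with the matrix `A`. -/
def quadForm {p d : ℕ} (A : Matrix (Fin d) (Fin d) (ZMod p)) (n : Fin d → ZMod p) : ZMod p :=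
  (n ᵥ* A) ⬝ᵥ n

/-- A configuration `X = (X_0, …, X_{m-1})` is `M`-spherical if all its points lie on a common
sphere `M(x - z) = ρ`. -/
def IsSpherical {p d m : ℕ} (A : Matrix (Fin d) (Fin d) (ZMod p))
    (X : Fin m → Fin d → ZMod p) : Prop :=
  ∃ (z : Fin d → ZMod p) (ρ : ZMod p), ∀ j, quadForm A (X j - z) = ρ

/-- `I` is a generating set of `X`: for some `i₀ ∈ I` the vectors `X_i - X_{i₀}`,
`i ∈ I \ {i₀}`, form a basis of `span(X - X)` (which is Mathlib's `vectorSpan`). -/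
def IsGeneratingSet {p d m : ℕ} [Fact p.Prime]
    (X : Fin m → Fin d → ZMod p) (I : Finset (Fin m)) : Prop :=
  ∃ i₀ : I,
    LinearIndependent (ZMod p) (fun i : {i : I // i ≠ i₀} => X i.1 - X i₀) ∧
    Submodule.span (ZMod p) (Set.range (fun i : {i : I // i ≠ i₀} => X i.1 - X i₀)) =
      vectorSpan (ZMod p) (Set.range X)

/-- The generating constants exist and are unique. -/
theorem existsUnique_genConst {p d m : ℕ} [Fact p.Prime]
    {X : Fin m → Fin d → ZMod p} {I : Finset (Fin m)} (hI : IsGeneratingSet X I) :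
    ∃! b : I → Fin m → ZMod p,
      (∀ j, ∑ i, b i j = 1) ∧ ∀ j, X j = ∑ i, b i j • X i := by
  obtain ⟨i₀, hli, hsp⟩ := hI
  -- sums over `I` split off the term at `i₀`
  have split : ∀ {E : Type} [AddCommGroup E] (g : I → E),
      ∑ i, g i = g i₀ + ∑ i : {i : I // i ≠ i₀}, g i.1 := by
    intro E _ g
    rw [Fintype.sum_eq_add_sum_compl i₀ g]
    congr 1
    exact Finset.sum_subtype _ (by simp) g
  have shift : ∀ e : I → ZMod p, ∑ i, e i • X i =
      (∑ i, e i) • X i₀ + ∑ i : {i : I // i ≠ i₀}, e i.1 • (X i.1 - X i₀) := by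
    intro e
    rw [split (fun i => e i • X i), split e, add_smul, Finset.sum_smul, add_assoc,
      ← Finset.sum_add_distrib]
    congr 1
    refine Finset.sum_congr rfl fun i _ => ?_
    rw [smul_sub]; abel
  have hex : ∀ j, ∃ c : {i : I // i ≠ i₀} → ZMod p,
      ∑ i, c i • (X i.1 - X i₀) = X j - X i₀ := by
    intro j
    have h : X j - X i₀ ∈ vectorSpan (ZMod p) (Set.range X) :=
      vsub_mem_vectorSpan _ ⟨j, rfl⟩ ⟨i₀, rfl⟩
    rw [← hsp] at h
    exact (Submodule.mem_span_range_iff_exists_fun _).1 h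
  choose c hc using hex
  have hb : ∀ j, ∑ i : I, (if h : i = i₀ then 1 - ∑ l, c j l else c j ⟨i, h⟩) = 1 := by
    intro j
    rw [split]
    have : ∀ l : {i : I // i ≠ i₀},
        (if h : l.1 = i₀ then 1 - ∑ l, c j l else c j ⟨l.1, h⟩) = c j l := by
      intro l; rw [dif_neg l.2]
    simp only [this]; simp
  refine ⟨fun i j => if h : i = i₀ then 1 - ∑ l, c j l else c j ⟨i, h⟩,
    ⟨hb, fun j => ?_⟩, ?_⟩
  · have h1 := shift (fun i => if h : i = i₀ then 1 - ∑ l, c j l else c j ⟨i, h⟩)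
    rw [h1, hb j]
    have : ∀ l : {i : I // i ≠ i₀},
        (if h : l.1 = i₀ then 1 - ∑ l, c j l else c j ⟨l.1, h⟩) = c j l := by
      intro l; rw [dif_neg l.2]
    simp only [this, hc j]; simp
  · have key : ∀ b b' : I → Fin m → ZMod p,
        ((∀ j, ∑ i, b i j = 1) ∧ ∀ j, X j = ∑ i, b i j • X i) →
        ((∀ j, ∑ i, b' i j = 1) ∧ ∀ j, X j = ∑ i, b' i j • X i) → b = b' := by
      intro b b' h h'
      have hz : ∀ j, ∀ i : {i : I // i ≠ i₀}, b i.1 j - b' i.1 j = 0 := by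
        intro j
        refine Fintype.linearIndependent_iff.1 hli (fun i => b i.1 j - b' i.1 j) ?_
        have h3 := shift (fun i => b i j - b' i j)
        simp only [sub_smul, Finset.sum_sub_distrib, ← h.2 j, ← h'.2 j, h.1 j, h'.1 j] at h3
        simpa [sub_smul] using h3.symm
      funext i j
      by_cases hi : i = i₀
      · have h1 := h.1 j
        rw [← h'.1 j, split (fun i => b i j), split (fun i => b' i j),
          Finset.sum_congr rfl (fun l _ => sub_eq_zero.1 (hz j l))] at h1
        rw [hi]
        exact add_right_cancel h1
      · exact sub_eq_zero.1 (hz j ⟨i, hi⟩)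
    intro b' h'
    refine key _ _ h' ⟨hb, fun j => ?_⟩
    have h1 := shift (fun i => if h : i = i₀ then 1 - ∑ l, c j l else c j ⟨i, h⟩)
    rw [h1, hb j]
    have : ∀ l : {i : I // i ≠ i₀},
        (if h : l.1 = i₀ then 1 - ∑ l, c j l else c j ⟨l.1, h⟩) = c j l := by
      intro l; rw [dif_neg l.2]
    simp only [this, hc j]; simp

/-- The generating constants `b_{I,i,j}` of `X` with respect to the generating set `I`: the unique
constants with `∑_{i ∈ I} b_{I,i,j} = 1` and `X_j = ∑_{i ∈ I} b_{I,i,j} X_i`. -/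
noncomputable def genConst {p d m : ℕ} [Fact p.Prime]
    {X : Fin m → Fin d → ZMod p} {I : Finset (Fin m)} (hI : IsGeneratingSet X I) :
    I → Fin m → ZMod p :=
  (existsUnique_genConst hI).exists.choose

/-- The generating map `𝐋_I : (𝔽_p^d)^I → (𝔽_p^d)^m`, whose `j`-th coordinate is
`∑_{i ∈ I} b_{I,i,j} x_i`. -/
noncomputable def genMap {p d m : ℕ} [Fact p.Prime]
    {X : Fin m → Fin d → ZMod p} {I : Finset (Fin m)} (hI : IsGeneratingSet X I)
    (x : I → Fin d → ZMod p) : Fin m → Fin d → ZMod p :=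
  fun j => ∑ i, genConst hI i j • x i

open scoped Classical in
/-- `Ω_I`: the tuples `(x_i)_{i ∈ I}` of points of the sphere `V(M - r)` that are `M`-isometric to
`(X_i)_{i ∈ I}`. -/
noncomputable def OmegaSub {p d m : ℕ} [Fact p.Prime]
    (A : Matrix (Fin d) (Fin d) (ZMod p)) (r : ZMod p)
    (X : Fin m → Fin d → ZMod p) (I : Finset (Fin m)) : Finset (I → Fin d → ZMod p) :=
  Finset.univ.filter fun x =>
    (∀ i, quadForm A (x i) = r) ∧
      ∀ i i', quadForm A (x i - x i') = quadForm A (X i - X i')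

open scoped Classical in
/-- `Ω = 𝐋_I(Ω_I)`: the almost `M`-congruent copies of `X` on the sphere `V(M - r)`. -/
noncomputable def Omega {p d m : ℕ} [Fact p.Prime]
    (A : Matrix (Fin d) (Fin d) (ZMod p)) (r : ZMod p)
    {X : Fin m → Fin d → ZMod p} {I : Finset (Fin m)} (hI : IsGeneratingSet X I) :
    Finset (Fin m → Fin d → ZMod p) :=
  (OmegaSub A r X I).image (genMap hI)

open scoped Classical in
/-- The `s`-th Gowers set `□_s(V(M - r))`: the tuples `(n, h_1, …, h_s)` all of whose cube points
`n + ε₁ h₁ + ⋯ + ε_s h_s` lie in `V(M - r)`. Here `ε ∈ {0,1}^s` is encoded by its support. -/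
noncomputable def gowersSet {p d : ℕ} [Fact p.Prime]
    (A : Matrix (Fin d) (Fin d) (ZMod p)) (r : ZMod p) (s : ℕ) :
    Finset ((Fin d → ZMod p) × (Fin s → Fin d → ZMod p)) :=
  Finset.univ.filter fun nh =>
    ∀ ε : Finset (Fin s), quadForm A (nh.1 + ∑ i ∈ ε, nh.2 i) = r

/-- The spherical Gowers norm `‖f‖_{U^s(V(M - r))}`; the iterated `starRingEnd ℂ` is `𝒞^{|ε|}`,
where `𝒞` is complex conjugation. It depends only on the values of `f` on `V(M - r)`. -/
noncomputable def gowersNorm {p d : ℕ} [Fact p.Prime]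
    (A : Matrix (Fin d) (Fin d) (ZMod p)) (r : ZMod p) (s : ℕ)
    (f : (Fin d → ZMod p) → ℂ) : ℝ :=
  ‖Finset.expect (gowersSet A r s) fun nh =>
      ∏ ε : Finset (Fin s), (starRingEnd ℂ)^[ε.card] (f (nh.1 + ∑ i ∈ ε, nh.2 i))‖
    ^ ((1 : ℝ) / 2 ^ s)

end SphericalGowers

/-!
Write `B` for the bilinear form of `A`. After choosing an affine frame `X o, X (e 1), …, X (e k)`
of the configuration, based at the point `o` of the distinguished function, `expect_Omega_eq`
identifies the almost congruent copies of `X` with the tuples `T = (T 0, …, T k)` whose Gram matrix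
is a fixed `G`: `T 0` is the base point and `T i` the frame vectors. Sphericality makes the shift
between `B (x j) (x j')` and `B (X j - z) (X j' - z)` constant, which is what puts all points of the
copy on the sphere.

The average is then controlled by `s` applications of Cauchy–Schwarz. The points other than `X o`
fall into `s` classes, and the functions at the points of class `b` do not see the translation
`T ↦ T + φ_b ⊗ h`, where `φ_b 0 = 1` (`exists_directions`). Each application removes one class and
turns the set of cubes `cubeSet a` into `cubeSet (a + 1)`, its fibre product over the quotient by
the direction `φ_a` (`norm_sum_cubeProd_sq_le`). In the end only the product of `f_o` over cubes
`T 0 + ∑_{b ∈ ε} h_b` is left, averaged over `cubeSet s`; this set has almost uniform fibres over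
the Gowers set of the sphere (`norm_expect_cubeSet_sub_le`).

All losses are counting errors. Each set that occurs is given by inhomogeneous quadratic equations
`B (x_i) (x_j) + l B (x_j) (x_j) = c`, one for each unordered pair in some set of pairs
(`cubeSet_eq_cubeEqs`). A nontrivial combination of these has a nonzero polar form, so
its character sums save `p ^ (d / 2)` over the trivial bound (`norm_charSum_gram_le`). Since `d`
exceeds twice the number of equations, this yields the expected count up to a factor
`1 + O(p ^ (-1/2))`. The final `2 ^ s`-th root gives the exponent `c = 1 / 2 ^ (s + 1)`. For `p = 2`
the bound is trivial.
-/

open scoped BigOperators Matrix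

namespace SphericalGowers

open ZMod (stdAddChar)

/-! ### Counting solutions with additive characters -/

theorem sum_stdAddChar_linear {p : ℕ} [Fact p.Prime] {W : Type*} [AddCommGroup W]
    [Module (ZMod p) W] [Fintype W] (L : W →ₗ[ZMod p] ZMod p) (hL : L ≠ 0) :
    ∑ w, stdAddChar (L w) = (0 : ℂ) := by
  have h : (stdAddChar (N := p)).compAddMonoidHom L.toAddMonoidHom ≠ 1 := by
    intro h
    apply hL
    ext w
    have h1 := DFunLike.congr_fun h w
    apply ZMod.injective_stdAddChar
    simpa using h1
  simpa using AddChar.sum_eq_zero_of_ne_one h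

/-- Orthogonality of characters: if every nontrivial character sum of the system `q` is at most
`K` in modulus, then each system `q = c` has the expected number of solutions up to `K`. -/
theorem abs_card_sub_le_of_norm_charSum_le {p : ℕ} [Fact p.Prime] {X E : Type*} [Fintype X]
    [Fintype E] (q : X → E → ZMod p) (c : E → ZMod p) (S : Finset X)
    (hS : ∀ x, x ∈ S ↔ ∀ e, q x e = c e) {K : ℝ} (hK0 : 0 ≤ K)
    (hK : ∀ ξ : E → ZMod p, ξ ≠ 0 → ‖∑ x, (stdAddChar (∑ e, ξ e * q x e) : ℂ)‖ ≤ K) :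
    |(S.card : ℝ) - Fintype.card X / (p : ℝ) ^ Fintype.card E| ≤ K := by
  classical
  have hp : (0 : ℝ) < (p : ℝ) ^ Fintype.card E := by
    have := (Fact.out : p.Prime).pos
    positivity
  have hcard : Fintype.card (E → ZMod p) = p ^ Fintype.card E := by simp [ZMod.card]
  have hind : ∀ x, ∑ ξ : E → ZMod p, (stdAddChar (∑ e, ξ e * (q x e - c e)) : ℂ) =
      if x ∈ S then (p : ℂ) ^ Fintype.card E else 0 := by
    intro x
    split_ifs with hx
    · rw [hS] at hx
      simp [hx, ZMod.card]
    · have : (Fintype.linearCombination (ZMod p) (fun e => q x e - c e)) ≠ 0 := by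
        intro h0
        apply hx
        rw [hS]
        intro e
        have h1 := LinearMap.congr_fun h0 (Pi.single e 1)
        simpa [Fintype.linearCombination_apply, Pi.single_apply, sub_eq_zero] using h1
      simpa [Fintype.linearCombination_apply] using sum_stdAddChar_linear _ this
  have htot : (S.card : ℂ) * (p : ℂ) ^ Fintype.card E =
      ∑ ξ : E → ZMod p, ∑ x, (stdAddChar (∑ e, ξ e * (q x e - c e)) : ℂ) := by
    rw [Finset.sum_comm]
    simp only [hind]
    simp [Finset.sum_ite_mem]
  have hsplit : (S.card : ℂ) * (p : ℂ) ^ Fintype.card E - Fintype.card X =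
      ∑ ξ ∈ Finset.univ.erase (0 : E → ZMod p),
        ∑ x, (stdAddChar (∑ e, ξ e * (q x e - c e)) : ℂ) := by
    rw [htot, ← Finset.add_sum_erase _ _ (Finset.mem_univ (0 : E → ZMod p))]
    simp
  have hterm : ∀ ξ ∈ Finset.univ.erase (0 : E → ZMod p),
      ‖∑ x, (stdAddChar (∑ e, ξ e * (q x e - c e)) : ℂ)‖ ≤ K := by
    intro ξ hξ
    have h1 : ∑ x, (stdAddChar (∑ e, ξ e * (q x e - c e)) : ℂ) =
        stdAddChar (-∑ e, ξ e * c e) * ∑ x, (stdAddChar (∑ e, ξ e * q x e) : ℂ) := by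
      rw [Finset.mul_sum]
      refine Finset.sum_congr rfl fun x _ => ?_
      rw [← AddChar.map_add_eq_mul]
      congr 1
      simp only [mul_sub, Finset.sum_sub_distrib]
      ring
    rw [h1, norm_mul, AddChar.norm_apply, one_mul]
    exact hK ξ (Finset.ne_of_mem_erase hξ)
  have hbound : |(S.card : ℝ) * (p : ℝ) ^ Fintype.card E - Fintype.card X| ≤
      (p : ℝ) ^ Fintype.card E * K := by
    have h2 : ‖(((S.card : ℝ) * (p : ℝ) ^ Fintype.card E - Fintype.card X : ℝ) : ℂ)‖ ≤
        (p : ℝ) ^ Fintype.card E * K := by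
      push_cast
      rw [hsplit]
      refine (norm_sum_le_of_le _ hterm).trans ?_
      rw [Finset.sum_const, nsmul_eq_mul]
      gcongr
      have := Finset.card_le_univ (Finset.univ.erase (0 : E → ZMod p))
      rw [hcard] at this
      exact_mod_cast this
    rwa [Complex.norm_real, Real.norm_eq_abs] at h2
  have h3 : (S.card : ℝ) - Fintype.card X / (p : ℝ) ^ Fintype.card E =
      ((S.card : ℝ) * (p : ℝ) ^ Fintype.card E - Fintype.card X) / (p : ℝ) ^ Fintype.card E := by
    field_simp
  rw [h3, abs_div, abs_of_pos hp, div_le_iff₀ hp]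
  linarith

/-- A function on `V^ι` whose second differences are bilinear, with a nonzero coefficient at
`(i₀, j₀)`, has a character sum showing square-root cancellation in one copy of `V`. -/
theorem norm_charSum_quadratic_le {p d : ℕ} [Fact p.Prime] {V ι : Type*} [AddCommGroup V]
    [Module (ZMod p) V] [Fintype V] [Fintype ι] [DecidableEq ι]
    (hV : Fintype.card V = p ^ d)
    (B : LinearMap.BilinForm (ZMod p) V) (hB : ∀ y, (∀ x, B x y = 0) → y = 0)
    (Q R : (ι → V) → ZMod p) (C : ι → ι → ZMod p)
    (hQ : ∀ x u, Q (x + u) - Q x = (∑ j, B (x j) (∑ i, C i j • u i)) + R u)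
    {i₀ j₀ : ι} (hC : C i₀ j₀ ≠ 0) :
    ‖∑ x, (stdAddChar (Q x) : ℂ)‖ ≤ (p : ℝ) ^ (d * Fintype.card ι) / √((p : ℝ) ^ d) := by
  classical
  have hp : (0 : ℝ) < (p : ℝ) := by
    have := (Fact.out : p.Prime).pos
    positivity
  have hVι : Fintype.card (ι → V) = p ^ (d * Fintype.card ι) := by
    simp [hV, pow_mul]
  -- Squaring the sum leaves only the shifts `u` killed by the polar form.
  let Z : Finset (ι → V) := Finset.univ.filter fun u => ∀ j, ∑ i, C i j • u i = 0
  have hsq : (‖∑ x, (stdAddChar (Q x) : ℂ)‖ ^ 2 : ℝ) ≤ (p : ℝ) ^ (d * Fintype.card ι) * Z.card := by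
    have h1 : ((‖∑ x, (stdAddChar (Q x) : ℂ)‖ ^ 2 : ℝ) : ℂ) =
        ∑ u, stdAddChar (R u) * ∑ x : ι → V,
          (stdAddChar (∑ j, B (x j) (∑ i, C i j • u i)) : ℂ) := by
      have h2 : ((‖∑ x, (stdAddChar (Q x) : ℂ)‖ ^ 2 : ℝ) : ℂ) =
          (∑ x, (stdAddChar (Q x) : ℂ)) * starRingEnd ℂ (∑ x, (stdAddChar (Q x) : ℂ)) := by
        rw [Complex.mul_conj, Complex.normSq_eq_norm_sq]
      rw [h2, map_sum, Finset.sum_mul_sum, Finset.sum_comm]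
      have h3 : ∀ x : ι → V, ∑ y, (stdAddChar (Q y) : ℂ) * starRingEnd ℂ (stdAddChar (Q x)) =
          ∑ u, stdAddChar (R u) * (stdAddChar (∑ j, B (x j) (∑ i, C i j • u i)) : ℂ) := by
        intro x
        rw [← Equiv.sum_comp (Equiv.addLeft x)]
        refine Finset.sum_congr rfl fun u _ => ?_
        rw [← AddChar.map_neg_eq_conj, ← AddChar.map_add_eq_mul, ← AddChar.map_add_eq_mul]
        congr 1
        simp only [Equiv.coe_addLeft]
        rw [← sub_eq_add_neg, hQ]
        ring
      simp only [h3]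
      rw [Finset.sum_comm]
      simp only [Finset.mul_sum]
    have h4 : ∀ u : ι → V, ‖(stdAddChar (R u) : ℂ) * ∑ x : ι → V,
          (stdAddChar (∑ j, B (x j) (∑ i, C i j • u i)) : ℂ)‖ ≤
        if u ∈ Z then (p : ℝ) ^ (d * Fintype.card ι) else 0 := by
      intro u
      rw [norm_mul, AddChar.norm_apply, one_mul]
      split_ifs with hu
      · refine (norm_sum_le _ _).trans ?_
        simp [hV, pow_mul]
      · let L : (ι → V) →ₗ[ZMod p] ZMod p :=
          ∑ j, (B.flip (∑ i, C i j • u i)).comp (LinearMap.proj j)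
        have hL : ∀ x, L x = ∑ j, B (x j) (∑ i, C i j • u i) := by
          intro x; simp only [L, LinearMap.sum_apply, LinearMap.comp_apply, LinearMap.proj_apply]
          rfl
        have hL0 : L ≠ 0 := by
          intro h0
          apply hu
          simp only [Z, Finset.mem_filter, Finset.mem_univ, true_and]
          intro j
          apply hB
          intro x
          have h5 := LinearMap.congr_fun h0 (Pi.single j x)
          rw [hL, Finset.sum_eq_single j] at h5
          · simpa using h5
          · intro b _ hb
            simp [hb]
          · simp
        have := sum_stdAddChar_linear L hL0
        simp only [hL] at this
        rw [this, norm_zero]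
    have h6 : (‖∑ x, (stdAddChar (Q x) : ℂ)‖ ^ 2 : ℝ) =
        ‖((‖∑ x, (stdAddChar (Q x) : ℂ)‖ ^ 2 : ℝ) : ℂ)‖ := by
      rw [Complex.norm_real, Real.norm_of_nonneg (by positivity)]
    rw [h6, h1]
    refine (norm_sum_le_of_le _ fun u _ => h4 u).trans ?_
    simp [Finset.sum_ite_mem, mul_comm]
  have hZ : Z.card * p ^ d ≤ p ^ (d * Fintype.card ι) := by
    rw [← hV, ← hVι, ← Finset.card_univ (α := V), ← Finset.card_product, ← Finset.card_univ]
    refine Finset.card_le_card_of_injOn (fun uv => uv.1 + Pi.single i₀ uv.2) (by simp) ?_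
    rintro ⟨u, v⟩ huv ⟨u', v'⟩ huv' h
    simp only [Z, Finset.coe_product, Set.mem_prod, Finset.mem_coe, Finset.mem_filter,
      Finset.mem_univ, true_and, and_true] at huv huv'
    have key : ∀ (u : ι → V) (v : V), (∀ j, ∑ i, C i j • u i = 0) →
        ∑ i, C i j₀ • (u + (Pi.single i₀ v : ι → V)) i = C i₀ j₀ • v := by
      intro u v hu
      simp only [Pi.add_apply, smul_add, Finset.sum_add_distrib, hu j₀, zero_add]
      rw [Finset.sum_eq_single i₀]
      · simp
      · intro b _ hb; simp [hb]
      · simp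
    have hv : v = v' := by
      have h7 := key u v huv
      simp only at h
      rw [h, key u' v' huv'] at h7
      exact (smul_right_injective V hC h7).symm
    subst hv
    simpa using h
  have hZ' : (Z.card : ℝ) ≤ (p : ℝ) ^ (d * Fintype.card ι) / (p : ℝ) ^ d := by
    rw [le_div_iff₀ (by positivity)]
    exact_mod_cast hZ
  refine abs_le_of_sq_le_sq' ?_ (by positivity) |>.2
  rw [div_pow, Real.sq_sqrt (by positivity)]
  calc _ ≤ _ := hsq
    _ ≤ (p : ℝ) ^ (d * Fintype.card ι) * ((p : ℝ) ^ (d * Fintype.card ι) / (p : ℝ) ^ d) := by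
        gcongr
    _ = _ := by ring

/-! ### Counting vectors with prescribed Gram data -/

/-- Character sums of nontrivial combinations of the equations
`B (x (src e)) (x (tgt e)) + l e * B (x (tgt e)) (x (tgt e)) = c e`, perturbed by a linear term.
The unordered pairs `{src e, tgt e}` are distinct, so that the combination has a nonzero polar
form. -/
theorem norm_charSum_gram_le {p d : ℕ} [Fact p.Prime] {V ι E : Type*} [AddCommGroup V]
    [Module (ZMod p) V] [Fintype V] [Fintype ι] [DecidableEq ι] [Fintype E] (hp2 : p ≠ 2)
    (hV : Fintype.card V = p ^ d) (B : LinearMap.BilinForm (ZMod p) V)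
    (hsymm : ∀ x y, B x y = B y x) (hB : ∀ y, (∀ x, B x y = 0) → y = 0)
    (src tgt : E → ι)
    (hinj : ∀ e e', (src e = src e' ∧ tgt e = tgt e') ∨ (src e = tgt e' ∧ tgt e = src e') → e = e')
    (l : E → ZMod p) (hl : ∀ e, src e = tgt e → l e = 0) (L : (ι → V) →ₗ[ZMod p] ZMod p)
    (ξ : E → ZMod p) (hξ : ξ ≠ 0) :
    ‖∑ x : ι → V, (stdAddChar (∑ e, ξ e * (B (x (src e)) (x (tgt e)) +
      l e * B (x (tgt e)) (x (tgt e))) + L x) : ℂ)‖ ≤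
      (p : ℝ) ^ (d * Fintype.card ι) / √((p : ℝ) ^ d) := by
  classical
  have h2 : (2 : ZMod p) ≠ 0 := by
    exact Ring.two_ne_zero (R := ZMod p) (by rw [ZMod.ringChar_zmod_n]; exact hp2)
  -- The matrix of the polar form of the combination with coefficients `ξ`.
  let C : ι → ι → ZMod p := fun i j => ∑ e, ξ e *
    ((if src e = i then 1 else 0) * (if tgt e = j then 1 else 0) +
      (if src e = j then 1 else 0) * (if tgt e = i then 1 else 0) +
      2 * l e * ((if tgt e = i then 1 else 0) * (if tgt e = j then 1 else 0)))
  have hC : ∃ i₀ j₀, C i₀ j₀ ≠ 0 := by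
    by_cases hoff : ∃ e, src e ≠ tgt e ∧ ξ e ≠ 0
    · obtain ⟨e₀, hne, h0⟩ := hoff
      refine ⟨src e₀, tgt e₀, ?_⟩
      simp only [C]
      rw [Finset.sum_eq_single e₀]
      · simp [hne, hne.symm, h0]
      · intro e _ he
        have h1 : ¬ (src e = src e₀ ∧ tgt e = tgt e₀) := fun h => he (hinj _ _ (Or.inl h))
        have h2 : ¬ (src e = tgt e₀ ∧ tgt e = src e₀) := fun h => he (hinj _ _ (Or.inr h))
        have h3 : ¬ (tgt e = src e₀ ∧ tgt e = tgt e₀) := fun h => hne (h.1.symm.trans h.2)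
        simp only [← ite_and, mul_ite, mul_one, mul_zero, if_neg h1, if_neg h2, if_neg h3,
          add_zero, and_comm] at *
      · simp
    · push Not at hoff
      obtain ⟨e₀, h0⟩ := Function.ne_iff.1 hξ
      have hd : src e₀ = tgt e₀ := by
        by_contra h; exact h0 (hoff _ h)
      refine ⟨tgt e₀, tgt e₀, ?_⟩
      simp only [C]
      rw [Finset.sum_eq_single e₀]
      · simp only [hd, hl _ hd, if_true]
        norm_num
        exact ⟨h0, by simpa [one_add_one_eq_two] using h2⟩
      · intro e _ he
        by_cases hs : src e = tgt e
        · have : tgt e ≠ tgt e₀ := fun h =>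
            he (hinj _ _ (Or.inl ⟨by rw [hs, hd, h], h⟩))
          simp [hs, this]
        · simp [hoff e hs]
      · simp
  obtain ⟨i₀, j₀, hC⟩ := hC
  refine norm_charSum_quadratic_le hV B hB _
    (fun u => ∑ e, ξ e * (B (u (src e)) (u (tgt e)) +
      l e * B (u (tgt e)) (u (tgt e))) + L u) C ?_ hC
  intro x u
  have hδ : ∀ (i₁ j₁ : ι) (g : ι → ι → ZMod p), ∑ j, ∑ i, (if i₁ = i then 1 else 0) *
      ((if j₁ = j then 1 else 0) * g j i) = g j₁ i₁ := by
    intro i₁ j₁ g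
    rw [Finset.sum_eq_single j₁ (fun j _ hj => by simp [hj.symm]) (by simp)]
    simp
  have hpol : ∑ j, B (x j) (∑ i, C i j • u i) = ∑ e, ξ e * (B (x (tgt e)) (u (src e)) +
      B (x (src e)) (u (tgt e)) + 2 * l e * B (x (tgt e)) (u (tgt e))) := by
    simp only [map_sum, map_smul, smul_eq_mul, C, Finset.sum_mul]
    rw [Finset.sum_congr rfl fun j _ => Finset.sum_comm, Finset.sum_comm]
    refine Finset.sum_congr rfl fun e _ => ?_
    simp only [mul_assoc, ← Finset.mul_sum, add_mul, Finset.sum_add_distrib, hδ]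
    simp
  rw [hpol, map_add]
  simp only [Pi.add_apply, map_add, LinearMap.add_apply]
  have : ∀ e, ξ e * (B (x (src e)) (x (tgt e)) + B (u (src e)) (x (tgt e)) +
      (B (x (src e)) (u (tgt e)) + B (u (src e)) (u (tgt e))) +
      l e * (B (x (tgt e)) (x (tgt e)) + B (u (tgt e)) (x (tgt e)) +
        (B (x (tgt e)) (u (tgt e)) + B (u (tgt e)) (u (tgt e))))) =
      ξ e * (B (x (src e)) (x (tgt e)) + l e * B (x (tgt e)) (x (tgt e))) +
      ξ e * (B (x (tgt e)) (u (src e)) + B (x (src e)) (u (tgt e)) +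
        2 * l e * B (x (tgt e)) (u (tgt e))) +
      ξ e * (B (u (src e)) (u (tgt e)) + l e * B (u (tgt e)) (u (tgt e))) := by
    intro e
    rw [hsymm (u (src e)) (x (tgt e)), hsymm (u (tgt e)) (x (tgt e))]
    ring
  simp only [this, Finset.sum_add_distrib]
  ring

theorem card_subtype_lt (n : ℕ) : Fintype.card {x : Fin n × Fin n // x.1 < x.2} = n.choose 2 := by
  rw [Fintype.card_subtype, Finset.card_filter, Fintype.sum_prod_type_right]
  simp only [Finset.sum_boole, Nat.cast_id, Finset.filter_gt_eq_Iio, Fin.card_Iio]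
  rw [Fin.sum_univ_eq_sum_range (fun i => i), Finset.sum_range_id, Nat.choose_two_right]

theorem card_subtype_le (n : ℕ) :
    Fintype.card {x : Fin n × Fin n // x.1 ≤ x.2} = (n + 1).choose 2 := by
  rw [Fintype.card_subtype, Finset.card_filter, Fintype.sum_prod_type_right]
  simp only [Finset.sum_boole, Nat.cast_id, Finset.filter_ge_eq_Iic, Fin.card_Iic]
  rw [Fin.sum_univ_eq_sum_range (fun i => i + 1), Nat.choose_two_right, ← Finset.sum_range_id,
    Finset.sum_range_succ']
  simp

/-- The system of equations on a base tuple `T` and directions `h` that describes the cubes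
spanned by `h` (with weights `φ`) all of whose vertices have Gram matrix `G`. -/
noncomputable def cubeEqs {p : ℕ} [Fact p.Prime] {V : Type*} [AddCommGroup V]
    [Module (ZMod p) V] [Fintype V] (B : LinearMap.BilinForm (ZMod p) V) {n : ℕ}
    (G : Fin n → Fin n → ZMod p) (φ : ℕ → Fin n → ZMod p) (a : ℕ) :
    Finset ((Fin n → V) × (Fin a → V)) :=
  open scoped Classical in
  Finset.univ.filter fun x => (∀ i j, B (x.1 i) (x.1 j) = G i j) ∧
    (∀ i b, B (x.1 i) (x.2 b) + φ b i / 2 * B (x.2 b) (x.2 b) = 0) ∧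
    ∀ b b', b ≠ b' → B (x.2 b) (x.2 b') = 0

/-- The number of independent equations in `cubeEqs`. -/
def eqCount (n a : ℕ) : ℕ := (n + 1).choose 2 + n * a + a.choose 2

theorem abs_card_cubeEqs_sub_le {p d : ℕ} [Fact p.Prime] {V : Type*} [AddCommGroup V]
    [Module (ZMod p) V] [Fintype V] (hp2 : p ≠ 2)
    (hV : Fintype.card V = p ^ d) (B : LinearMap.BilinForm (ZMod p) V)
    (hsymm : ∀ x y, B x y = B y x) (hB : ∀ y, (∀ x, B x y = 0) → y = 0) {n : ℕ}
    (G : Fin n → Fin n → ZMod p) (hG : ∀ i j, G i j = G j i) (φ : ℕ → Fin n → ZMod p) (a : ℕ) :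
    |((cubeEqs B G φ a).card : ℝ) - (p : ℝ) ^ (d * (n + a)) / (p : ℝ) ^ eqCount n a| ≤
      (p : ℝ) ^ (d * (n + a)) / √((p : ℝ) ^ d) := by
  classical
  let E := {x : Fin n × Fin n // x.1 ≤ x.2} ⊕ (Fin n × Fin a) ⊕ {x : Fin a × Fin a // x.1 < x.2}
  let src : E → Fin n ⊕ Fin a := Sum.elim (fun x => .inl x.1.1)
    (Sum.elim (fun x => .inl x.1) (fun x => .inr x.1.1))
  let tgt : E → Fin n ⊕ Fin a := Sum.elim (fun x => .inl x.1.2)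
    (Sum.elim (fun x => .inr x.2) (fun x => .inr x.1.2))
  let l : E → ZMod p := Sum.elim 0 (Sum.elim (fun x => φ x.2 x.1 / 2) 0)
  let c : E → ZMod p := Sum.elim (fun x => G x.1.1 x.1.2) 0
  have hE : Fintype.card E = eqCount n a := by
    simp only [E, Fintype.card_sum, card_subtype_le, card_subtype_lt, Fintype.card_prod,
      Fintype.card_fin, eqCount, add_assoc]
  let q : (Fin n ⊕ Fin a → V) → E → ZMod p := fun x e =>
    B (x (src e)) (x (tgt e)) + l e * B (x (tgt e)) (x (tgt e))
  let σ := (Equiv.sumArrowEquivProdArrow (Fin n) (Fin a) V).symm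
  have key := abs_card_sub_le_of_norm_charSum_le q c ((cubeEqs B G φ a).map σ.toEmbedding)
    (K := (p : ℝ) ^ (d * Fintype.card (Fin n ⊕ Fin a)) / √((p : ℝ) ^ d)) ?_ ?_ ?_
  · rw [hE] at key
    simpa [hV, ← pow_mul] using key
  · intro x
    simp only [Finset.mem_map_equiv, cubeEqs, Finset.mem_filter, Finset.mem_univ, true_and, q, σ,
      Sum.forall, E, src, tgt, l, c]
    simp only [Equiv.symm_symm, Equiv.sumArrowEquivProdArrow, Equiv.coe_fn_mk, Sum.elim_inl,
      Sum.elim_inr, Pi.zero_apply, zero_mul, add_zero, Function.comp_apply, Subtype.forall,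
      Prod.forall]
    refine and_congr ⟨fun h i j _ => h i j, fun h i j => ?_⟩ (and_congr Iff.rfl
      ⟨fun h b b' hb => h b b' hb.ne, fun h b b' hb => ?_⟩)
    · rcases le_total i j with hij | hij
      · exact h i j hij
      · rw [hsymm, hG]; exact h j i hij
    · rcases lt_or_gt_of_ne hb with hb | hb
      · exact h b b' hb
      · rw [hsymm]; exact h b' b hb
  · positivity
  · intro ξ hξ
    have := norm_charSum_gram_le hp2 hV B hsymm hB src tgt ?_ l ?_ 0 ξ hξ
    · simpa [q] using this
    · rintro (⟨⟨i, j⟩, h⟩ | ⟨i, j⟩ | ⟨⟨i, j⟩, h⟩) (⟨⟨i', j'⟩, h'⟩ | ⟨i', j'⟩ | ⟨⟨i', j'⟩, h'⟩) <;>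
        simp only [src, tgt, E, Sum.elim_inl, Sum.elim_inr, Sum.inl.injEq, Sum.inr.injEq,
          reduceCtorEq, Subtype.mk.injEq, Prod.mk.injEq, false_and, and_false, or_false,
          IsEmpty.forall_iff, or_self] <;> (try simp only at h) <;>
        (try simp only at h') <;> omega
    · rintro (⟨⟨i, j⟩, h⟩ | ⟨i, j⟩ | ⟨⟨i, j⟩, h⟩) <;> simp [src, tgt, l]

/-- Vectors with prescribed Gram matrix and prescribed inner products with linearly independent
vectors `v`. -/
theorem abs_card_gram_fibre_sub_le {p d : ℕ} [Fact p.Prime] {V : Type*} [AddCommGroup V]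
    [Module (ZMod p) V] [Fintype V] (hp2 : p ≠ 2)
    (hV : Fintype.card V = p ^ d) (B : LinearMap.BilinForm (ZMod p) V)
    (hsymm : ∀ x y, B x y = B y x) (hB : ∀ y, (∀ x, B x y = 0) → y = 0) {k m : ℕ}
    (G : Fin k → Fin k → ZMod p) (hG : ∀ i j, G i j = G j i) (v : Fin m → V)
    (hv : LinearIndependent (ZMod p) v) (c : Fin k → Fin m → ZMod p)
    (S : Finset (Fin k → V))
    (hS : ∀ t, t ∈ S ↔ (∀ i j, B (t i) (t j) = G i j) ∧ ∀ i b, B (t i) (v b) = c i b) :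
    |(S.card : ℝ) - (p : ℝ) ^ (d * k) / (p : ℝ) ^ ((k + 1).choose 2 + k * m)| ≤
      (p : ℝ) ^ (d * k) / √((p : ℝ) ^ d) := by
  classical
  let E := {x : Fin k × Fin k // x.1 ≤ x.2} ⊕ (Fin k × Fin m)
  let q : (Fin k → V) → E → ZMod p := fun t =>
    Sum.elim (fun x => B (t x.1.1) (t x.1.2)) (fun x => B (t x.1) (v x.2))
  have hE : Fintype.card E = (k + 1).choose 2 + k * m := by
    simp only [E, Fintype.card_sum, card_subtype_le, Fintype.card_prod, Fintype.card_fin]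
  have key := abs_card_sub_le_of_norm_charSum_le q
    (Sum.elim (fun x => G x.1.1 x.1.2) (fun x => c x.1 x.2)) S
    (K := (p : ℝ) ^ (d * Fintype.card (Fin k)) / √((p : ℝ) ^ d)) ?_ ?_ ?_
  · rw [hE] at key
    simpa [hV, ← pow_mul] using key
  · intro t
    rw [hS]
    simp only [Sum.forall, E, q, Sum.elim_inl, Sum.elim_inr, Subtype.forall, Prod.forall]
    refine and_congr ⟨fun h i j _ => h i j, fun h i j => ?_⟩ Iff.rfl
    rcases le_total i j with hij | hij
    · exact h i j hij
    · rw [hsymm, hG]; exact h j i hij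
  · positivity
  · intro ξ hξ
    let L : (Fin k → V) →ₗ[ZMod p] ZMod p :=
      ∑ i, (B.flip (∑ b, ξ (.inr (i, b)) • v b)).comp (LinearMap.proj i)
    have hL : ∀ t, L t = ∑ i, B (t i) (∑ b, ξ (.inr (i, b)) • v b) := by
      intro x; simp only [L, LinearMap.sum_apply, LinearMap.comp_apply, LinearMap.proj_apply]
      rfl
    have hq : ∀ t, ∑ e, ξ e * q t e =
        ∑ e : {x : Fin k × Fin k // x.1 ≤ x.2}, ξ (.inl e) * (B (t e.1.1) (t e.1.2) +
          0 * B (t e.1.2) (t e.1.2)) + L t := by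
      intro t
      rw [Fintype.sum_sum_type, hL]
      simp only [q, Sum.elim_inl, Sum.elim_inr, zero_mul, add_zero, map_sum, map_smul, smul_eq_mul,
        Fintype.sum_prod_type]
    simp only [hq]
    -- Without a quadratic part the sum vanishes, by independence of `v`.
    by_cases h0 : (fun e => ξ (.inl e)) = (0 : {x : Fin k × Fin k // x.1 ≤ x.2} → ZMod p)
    · have hL0 : L ≠ 0 := by
        intro h
        apply hξ
        have h1 : ∀ i, ∑ b, ξ (.inr (i, b)) • v b = 0 := by
          intro i
          apply hB
          intro x
          have h5 := LinearMap.congr_fun h (Pi.single i x)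
          rw [hL, Finset.sum_eq_single i] at h5
          · simpa using h5
          · intro b _ hb
            simp [hb]
          · simp
        ext e
        rcases e with e | ⟨i, b⟩
        · exact congr_fun h0 e
        · exact Fintype.linearIndependent_iff.1 hv _ (h1 i) b
      have h3 : ∀ e, ξ (.inl e) = 0 := congr_fun h0
      simp only [h3, zero_mul, Finset.sum_const_zero, zero_add]
      rw [sum_stdAddChar_linear L hL0, norm_zero]
      positivity
    · refine norm_charSum_gram_le hp2 hV B hsymm hB
        (E := {x : Fin k × Fin k // x.1 ≤ x.2}) (fun e => e.1.1) (fun e => e.1.2) ?_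
        (fun _ => 0) (fun _ _ => rfl) L _ h0
      rintro ⟨⟨i, j⟩, h⟩ ⟨⟨i', j'⟩, h'⟩
      simp only [Subtype.mk.injEq, Prod.mk.injEq]
      simp only at h h'
      omega

/-- Few tuples of vectors are linearly dependent. -/
theorem card_dependent_le {p d : ℕ} [Fact p.Prime] {V : Type*} [AddCommGroup V]
    [Module (ZMod p) V] [Fintype V] (hV : Fintype.card V = p ^ d) {m : ℕ}
    (S : Finset (Fin (m + 1) → V)) (hS : ∀ v ∈ S, ¬ LinearIndependent (ZMod p) v) :
    S.card ≤ p ^ (m + 1 + d * m) := by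
  classical
  have h1 : ∀ v ∈ S, ∃ g : Fin (m + 1) → ZMod p, ∑ i, g i • v i = 0 ∧ ∃ i, g i ≠ 0 := by
    intro v hv
    exact Fintype.not_linearIndependent_iff.1 (hS v hv)
  choose! g hg hg0 using h1
  have h2 : ∀ c : Fin (m + 1) → ZMod p, ∃ i, (∃ i, c i ≠ 0) → c i ≠ 0 := by
    intro c
    by_cases h : ∃ i, c i ≠ 0
    · obtain ⟨i, hi⟩ := h
      exact ⟨i, fun _ => hi⟩
    · exact ⟨0, fun h' => absurd h' h⟩
  choose i hi using h2
  -- A dependent tuple is recovered from the coefficients of a relation and all entries but one.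
  have hcard : Fintype.card ((Fin (m + 1) → ZMod p) × (Fin m → V)) = p ^ (m + 1 + d * m) := by
    simp [hV, ZMod.card, pow_add, pow_mul]
  rw [← hcard, ← Finset.card_univ]
  refine Finset.card_le_card_of_injOn (fun v => (g v, fun j => v ((i (g v)).succAbove j)))
    (by simp) ?_
  intro v hv v' hv' h
  simp only [Prod.mk.injEq] at h
  obtain ⟨hgg, h⟩ := h
  rw [← hgg] at h
  have hrest : ∀ j, v ((i (g v)).succAbove j) = v' ((i (g v)).succAbove j) := congr_fun h
  have e1 := hg v hv
  have e2 := hg v' hv'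
  rw [← hgg] at e2
  rw [Fin.sum_univ_succAbove _ (i (g v))] at e1 e2
  simp only [hrest] at e1
  have h3 : v (i (g v)) = v' (i (g v)) :=
    smul_right_injective V (hi _ (hg0 v hv)) (add_right_cancel (e1.trans e2.symm))
  funext j
  rcases Fin.eq_self_or_eq_succAbove (i (g v)) j with rfl | ⟨j, rfl⟩
  · exact h3
  · exact hrest j

/-! ### Cubes and the Cauchy–Schwarz step -/

section

theorem prod_finset_fin_succ {M : Type*} [CommMonoid M] {a : ℕ} (f : Finset (Fin (a + 1)) → M) :
    ∏ ε, f ε = (∏ ε : Finset (Fin a), f (ε.map Fin.castSuccEmb)) *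
      ∏ ε : Finset (Fin a), f (insert (Fin.last a) (ε.map Fin.castSuccEmb)) := by
  classical
  have hinj : Set.InjOn (fun ε => Finset.image Fin.castSuccEmb ε)
      ((Finset.univ : Finset (Fin a)).powerset : Set (Finset (Fin a))) :=
    (Finset.image_injective Fin.castSuccEmb.injective).injOn
  rw [← Finset.powerset_univ, Fin.univ_castSuccEmb, Finset.cons_eq_insert,
    Finset.prod_powerset_insert (by simp), Finset.map_eq_image, Finset.powerset_image,
    Finset.prod_image hinj, Finset.prod_image hinj]
  simp [Finset.map_eq_image]

theorem forall_finset_fin_succ {a : ℕ} {P : Finset (Fin (a + 1)) → Prop} :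
    (∀ ε, P ε) ↔ (∀ ε : Finset (Fin a), P (ε.map Fin.castSuccEmb)) ∧
      ∀ ε : Finset (Fin a), P (insert (Fin.last a) (ε.map Fin.castSuccEmb)) := by
  classical
  refine ⟨fun h => ⟨fun _ => h _, fun _ => h _⟩, fun h ε => ?_⟩
  have key : ∀ ε : Finset (Fin (a + 1)), Fin.last a ∉ ε →
      ε = (Finset.univ.filter fun i : Fin a => i.castSucc ∈ ε).map Fin.castSuccEmb := by
    intro ε hε
    ext i
    refine Fin.lastCases ?_ (fun j => ?_) i
    · simpa using hε
    · simp
  by_cases hε : Fin.last a ∈ ε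
  · rw [← Finset.insert_erase hε, key (ε.erase (Fin.last a)) (by simp)]
    exact h.2 _
  · rw [key ε hε]
    exact h.1 _

variable {p : ℕ} [Fact p.Prime] {V : Type*} [AddCommGroup V] [Module (ZMod p) V]

/-- The vertex `T + ∑_{b ∈ ε} φ_b ⊗ h_b` of the cube with base tuple `T`. -/
def cubePt {n : ℕ} (φ : ℕ → Fin n → ZMod p) {a : ℕ} (T : Fin n → V) (h : Fin a → V)
    (ε : Finset (Fin a)) : Fin n → V :=
  fun i => T i + ∑ b ∈ ε, φ b i • h b

theorem cubePt_snoc {n : ℕ} (φ : ℕ → Fin n → ZMod p) {a : ℕ} (T : Fin n → V) (h : Fin a → V)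
    (u : V) (ε : Finset (Fin a)) :
    cubePt φ T (Fin.snoc h u : Fin (a + 1) → V) (ε.map Fin.castSuccEmb) = cubePt φ T h ε := by
  funext i
  simp [cubePt]

theorem cubePt_snoc_insert {n : ℕ} (φ : ℕ → Fin n → ZMod p) {a : ℕ} (T : Fin n → V)
    (h : Fin a → V) (u : V) (ε : Finset (Fin a)) :
    cubePt φ T (Fin.snoc h u : Fin (a + 1) → V) (insert (Fin.last a) (ε.map Fin.castSuccEmb)) =
      cubePt φ (fun i => T i + φ a i • u) h ε := by
  funext i
  rw [cubePt, Finset.sum_insert (by simp)]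
  simp [cubePt, add_assoc]

theorem cubePt_add_smul {n : ℕ} (φ : ℕ → Fin n → ZMod p) {a : ℕ} (T : Fin n → V)
    (h : Fin a → V) (c : Fin n → ZMod p) (u : V) (ε : Finset (Fin a)) :
    cubePt φ (fun i => T i + c i • u) h ε = fun i => cubePt φ T h ε i + c i • u := by
  funext i
  simp only [cubePt]
  abel

theorem cubePt_zero {k : ℕ} {φ : ℕ → Fin (k + 1) → ZMod p} (hφ : ∀ b, φ b 0 = 1) {s : ℕ}
    (T : Fin (k + 1) → V) (h : Fin s → V) (ε : Finset (Fin s)) :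
    cubePt φ T h ε 0 = T 0 + ∑ i ∈ ε, h i := by
  simp [cubePt, hφ]

/-- The multiplicative derivative of `F` along the cube `x = (T, h)`. -/
noncomputable def cubeProd {n : ℕ} (φ : ℕ → Fin n → ZMod p) (a : ℕ) (F : (Fin n → V) → ℂ)
    (x : (Fin n → V) × (Fin a → V)) : ℂ :=
  ∏ ε : Finset (Fin a), (starRingEnd ℂ)^[ε.card] (F (cubePt φ x.1 x.2 ε))

theorem cubeProd_mul {n : ℕ} (φ : ℕ → Fin n → ZMod p) (a : ℕ) (F F' : (Fin n → V) → ℂ)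
    (x : (Fin n → V) × (Fin a → V)) :
    cubeProd φ a (fun T => F T * F' T) x = cubeProd φ a F x * cubeProd φ a F' x := by
  simp only [cubeProd, iterate_map_mul, Finset.prod_mul_distrib]

theorem cubeProd_snoc {n : ℕ} (φ : ℕ → Fin n → ZMod p) (a : ℕ) (F : (Fin n → V) → ℂ)
    (T : Fin n → V) (h : Fin a → V) (u : V) :
    cubeProd φ (a + 1) F (T, Fin.snoc h u) =
      cubeProd φ a F (T, h) * starRingEnd ℂ (cubeProd φ a F (fun i => T i + φ a i • u, h)) := by
  rw [cubeProd, prod_finset_fin_succ]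
  congr 1
  · simp only [cubePt_snoc, Finset.card_map]
    rfl
  · rw [cubeProd, map_prod]
    refine Finset.prod_congr rfl fun ε _ => ?_
    rw [cubePt_snoc_insert, Finset.card_insert_of_notMem (by simp), Finset.card_map,
      Function.iterate_succ_apply']

theorem norm_iterate_conj (m : ℕ) (z : ℂ) : ‖(starRingEnd ℂ)^[m] z‖ = ‖z‖ := by
  induction m with
  | zero => rfl
  | succ m ih => rw [Function.iterate_succ_apply', RCLike.norm_conj, ih]

theorem norm_cubeProd_le_one {n : ℕ} (φ : ℕ → Fin n → ZMod p) (a : ℕ) (F : (Fin n → V) → ℂ)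
    (x : (Fin n → V) × (Fin a → V)) (h : ∀ ε, ‖F (cubePt φ x.1 x.2 ε)‖ ≤ 1) :
    ‖cubeProd φ a F x‖ ≤ 1 := by
  rw [cubeProd, norm_prod]
  exact Finset.prod_le_one (fun _ _ => norm_nonneg _) fun ε _ => by
    rw [norm_iterate_conj]; exact h ε

/-- The Cauchy–Schwarz inequality over the fibres of `π`. -/
theorem norm_sum_mul_sq_le {σ τ : Type*} [DecidableEq τ] (S : Finset σ) (π : σ → τ)
    (g : τ → ℂ) (hg : ∀ x ∈ S, ‖g (π x)‖ ≤ 1) (F : σ → ℂ) :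
    ‖∑ x ∈ S, g (π x) * F x‖ ^ 2 ≤ ((S.image π).card : ℝ) *
      ‖∑ x ∈ (S ×ˢ S).filter (fun x => π x.1 = π x.2), F x.1 * starRingEnd ℂ (F x.2)‖ := by
  have h1 : ∑ x ∈ S, g (π x) * F x = ∑ y ∈ S.image π, g y * ∑ x ∈ S.filter (π · = y), F x := by
    rw [← Finset.sum_fiberwise_of_maps_to (g := π) (t := S.image π)
      (fun x hx => Finset.mem_image_of_mem _ hx)]
    refine Finset.sum_congr rfl fun y _ => ?_
    rw [Finset.mul_sum]
    refine Finset.sum_congr rfl fun x hx => ?_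
    rw [(Finset.mem_filter.1 hx).2]
  have h2 : ∑ x ∈ (S ×ˢ S).filter (fun x => π x.1 = π x.2), F x.1 * starRingEnd ℂ (F x.2) =
      ((∑ y ∈ S.image π, ‖∑ x ∈ S.filter (π · = y), F x‖ ^ 2 : ℝ) : ℂ) := by
    rw [← Finset.sum_fiberwise_of_maps_to (g := fun x : σ × σ => π x.1) (t := S.image π)
      (fun x hx => Finset.mem_image_of_mem _ (Finset.mem_product.1 (Finset.mem_filter.1 hx).1).1),
      Complex.ofReal_sum]
    refine Finset.sum_congr rfl fun y _ => ?_
    rw [← Complex.normSq_eq_norm_sq, ← Complex.mul_conj, map_sum, Finset.sum_mul_sum,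
      ← Finset.sum_product']
    refine Finset.sum_congr ?_ fun _ _ => rfl
    ext x
    simp only [Finset.mem_filter, Finset.mem_product]
    constructor
    · rintro ⟨⟨h, h'⟩, rfl⟩; exact ⟨⟨h.1, rfl⟩, h.2, h'.symm⟩
    · rintro ⟨⟨h, rfl⟩, h', h''⟩; exact ⟨⟨⟨h, h'⟩, h''.symm⟩, rfl⟩
  rw [h2, Complex.norm_real, Real.norm_of_nonneg (by positivity), h1]
  have h3 : ‖∑ y ∈ S.image π, g y * ∑ x ∈ S.filter (π · = y), F x‖ ≤
      ∑ y ∈ S.image π, ‖∑ x ∈ S.filter (π · = y), F x‖ := by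
    refine norm_sum_le_of_le _ fun y hy => ?_
    obtain ⟨x, hx, rfl⟩ := Finset.mem_image.1 hy
    rw [norm_mul]
    exact mul_le_of_le_one_left (norm_nonneg _) (hg x hx)
  exact (pow_le_pow_left₀ (norm_nonneg _) h3 2).trans sq_sum_le_card_mul_sum_sq

variable [Fintype V]

/-- The tuples of vectors with Gram matrix `G`. -/
noncomputable def gramSet (B : LinearMap.BilinForm (ZMod p) V) {n : ℕ}
    (G : Fin n → Fin n → ZMod p) : Finset (Fin n → V) :=
  open scoped Classical in Finset.univ.filter fun T => ∀ i j, B (T i) (T j) = G i j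

/-- The cubes all of whose vertices have Gram matrix `G`. -/
noncomputable def cubeSet (B : LinearMap.BilinForm (ZMod p) V) {n : ℕ}
    (G : Fin n → Fin n → ZMod p) (φ : ℕ → Fin n → ZMod p) (a : ℕ) :
    Finset ((Fin n → V) × (Fin a → V)) :=
  open scoped Classical in
  Finset.univ.filter fun x => ∀ ε, cubePt φ x.1 x.2 ε ∈ gramSet B G

theorem mem_gramSet {B : LinearMap.BilinForm (ZMod p) V} {n : ℕ}
    {G : Fin n → Fin n → ZMod p} {T : Fin n → V} :
    T ∈ gramSet B G ↔ ∀ i j, B (T i) (T j) = G i j := by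
  simp [gramSet]

theorem mem_cubeSet {B : LinearMap.BilinForm (ZMod p) V} {n : ℕ}
    {G : Fin n → Fin n → ZMod p} {φ : ℕ → Fin n → ZMod p} {a : ℕ}
    {x : (Fin n → V) × (Fin a → V)} :
    x ∈ cubeSet B G φ a ↔ ∀ ε, cubePt φ x.1 x.2 ε ∈ gramSet B G := by
  simp [cubeSet]

theorem mem_cubeEqs {B : LinearMap.BilinForm (ZMod p) V} {n : ℕ}
    {G : Fin n → Fin n → ZMod p} {φ : ℕ → Fin n → ZMod p} {a : ℕ}
    {x : (Fin n → V) × (Fin a → V)} :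
    x ∈ cubeEqs B G φ a ↔ (∀ i j, B (x.1 i) (x.1 j) = G i j) ∧
      (∀ i b, B (x.1 i) (x.2 b) + φ b i / 2 * B (x.2 b) (x.2 b) = 0) ∧
      ∀ b b', b ≠ b' → B (x.2 b) (x.2 b') = 0 := by
  simp [cubeEqs]

theorem mem_cubeSet_snoc {B : LinearMap.BilinForm (ZMod p) V} {n : ℕ}
    {G : Fin n → Fin n → ZMod p} {φ : ℕ → Fin n → ZMod p} {a : ℕ}
    {T : Fin n → V} {h : Fin a → V} {u : V} :
    (T, (Fin.snoc h u : Fin (a + 1) → V)) ∈ cubeSet B G φ (a + 1) ↔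
      (T, h) ∈ cubeSet B G φ a ∧ (fun i => T i + φ a i • u, h) ∈ cubeSet B G φ a := by
  simp only [mem_cubeSet, forall_finset_fin_succ, cubePt_snoc, cubePt_snoc_insert]

theorem two_ne_zero_zmod (hp2 : p ≠ 2) : (2 : ZMod p) ≠ 0 :=
  Ring.two_ne_zero (R := ZMod p) (by rw [ZMod.ringChar_zmod_n]; exact hp2)

/-- Expanding the Gram matrix of the vertices as a polynomial in `ε` gives the equations
`cubeEqs`. -/
theorem cubeSet_eq_cubeEqs (hp2 : p ≠ 2) {B : LinearMap.BilinForm (ZMod p) V}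
    (hsymm : ∀ x y, B x y = B y x) {k : ℕ}
    (G : Fin (k + 1) → Fin (k + 1) → ZMod p) (φ : ℕ → Fin (k + 1) → ZMod p)
    (hφ : ∀ b, φ b 0 = 1) (a : ℕ) : cubeSet B G φ a = cubeEqs B G φ a := by
  classical
  have h2 := two_ne_zero_zmod hp2
  ext ⟨T, h⟩
  simp only [mem_cubeSet, mem_gramSet, mem_cubeEqs]
  constructor
  · intro H
    have H0 : ∀ i j, B (T i) (T j) = G i j := by
      intro i j; simpa [cubePt] using H ∅ i j
    have H1 : ∀ (b : Fin a) i j, φ b j * B (T i) (h b) + φ b i * B (T j) (h b) +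
        φ b i * φ b j * B (h b) (h b) = 0 := by
      intro b i j
      have h3 := H {b} i j
      simp only [cubePt, Finset.sum_singleton, map_add, LinearMap.add_apply, map_smul,
        LinearMap.smul_apply, smul_eq_mul, H0, hsymm (h b) (T j)] at h3
      linear_combination h3
    have H2 : ∀ i b, B (T i) (h b) + φ b i / 2 * B (h b) (h b) = 0 := by
      intro i b
      have h3 := H1 b i 0
      have h4 := H1 b 0 0
      simp only [hφ] at h3 h4
      field_simp
      linear_combination 2 * h3 - φ b i * h4
    refine ⟨H0, H2, fun b b' hb => ?_⟩
    have h3 := H {b, b'} 0 0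
    simp only [cubePt, Finset.sum_pair hb, map_add, LinearMap.add_apply, map_smul,
      LinearMap.smul_apply, smul_eq_mul, H0, hsymm (h _) (T _), hφ, hsymm (h b') (h b)] at h3
    have h4 := H1 b 0 0
    have h5 := H1 b' 0 0
    simp only [hφ] at h4 h5
    have h6 : 2 * B (h b) (h b') = 0 := by linear_combination h3 - h4 - h5
    exact (mul_eq_zero.1 h6).resolve_left h2
  · rintro ⟨H0, H2, H3⟩ ε i j
    simp only [cubePt, map_add, LinearMap.add_apply, map_sum, map_smul, LinearMap.sum_apply,
      LinearMap.smul_apply, smul_eq_mul, H0, hsymm (h _) (T _)]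
    have e2 : ∀ b ∈ ε, ∑ b' ∈ ε, φ b' i * B (h b') (h b) =
        φ b i * B (h b) (h b) := by
      intro b hb
      refine Finset.sum_eq_single b (fun b' _ hb' => ?_) (fun h => absurd hb h)
      rw [H3 b' b hb', mul_zero]
    have e3 : ∀ i b, B (T i) (h b) = - (φ b i / 2 * B (h b) (h b)) := fun i b =>
      eq_neg_of_add_eq_zero_left (H2 i b)
    rw [add_assoc, ← Finset.sum_add_distrib, Finset.sum_eq_zero, add_zero]
    intro b hb
    rw [e2 b hb, e3, e3]
    field_simp
    ring

/-- The map killing the direction `c` in tuples with `c 0 = 1`. -/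
def collapse {n : ℕ} (c : Fin (n + 1) → ZMod p) {a : ℕ}
    (x : (Fin (n + 1) → V) × (Fin a → V)) : (Fin (n + 1) → V) × (Fin a → V) :=
  (fun i => x.1 i - c i • x.1 0, x.2)

/-- One application of Cauchy–Schwarz removes a factor `F₁` that is invariant in the direction
`φ a`, at the cost of one more cube direction. -/
theorem norm_sum_cubeProd_sq_le (B : LinearMap.BilinForm (ZMod p) V) {k : ℕ} [DecidableEq V]
    (G : Fin (k + 1) → Fin (k + 1) → ZMod p) (φ : ℕ → Fin (k + 1) → ZMod p)
    (hφ : ∀ b, φ b 0 = 1) (a : ℕ) (F₁ F₂ : (Fin (k + 1) → V) → ℂ)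
    (hinv : ∀ T u, F₁ (fun i => T i + φ a i • u) = F₁ T) (hF₁ : ∀ T ∈ gramSet B G, ‖F₁ T‖ ≤ 1) :
    ‖∑ x ∈ cubeSet B G φ a, cubeProd φ a (fun T => F₁ T * F₂ T) x‖ ^ 2 ≤
      (((cubeSet B G φ a).image (collapse (φ a))).card : ℝ) *
        ‖∑ x ∈ cubeSet B G φ (a + 1), cubeProd φ (a + 1) F₂ x‖ := by
  have hcol : ∀ x : (Fin (k + 1) → V) × (Fin a → V),
      cubeProd φ a F₁ (collapse (φ a) x) = cubeProd φ a F₁ x := by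
    rintro ⟨T, h⟩
    rw [cubeProd, cubeProd]
    refine Finset.prod_congr rfl fun ε _ => ?_
    have : (collapse (φ a) (T, h)).1 = fun i => T i + φ a i • (-T 0) := by
      funext i; simp [collapse, sub_eq_add_neg]
    rw [this]
    simp only [collapse]
    rw [cubePt_add_smul, hinv]
  have h1 : ∀ x, cubeProd φ a (fun T => F₁ T * F₂ T) x =
      cubeProd φ a F₁ (collapse (φ a) x) * cubeProd φ a F₂ x := by
    intro x; rw [cubeProd_mul, hcol]
  simp only [h1]
  refine (norm_sum_mul_sq_le _ (collapse (φ a)) (cubeProd φ a F₁) ?_ _).trans (le_of_eq ?_)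
  · intro x hx
    rw [hcol]
    exact norm_cubeProd_le_one _ _ _ _ fun ε => hF₁ _ (mem_cubeSet.1 hx ε)
  congr 2
  -- The fibre product of `cubeSet a` with itself is `cubeSet (a + 1)`.
  have htr : ∀ (T T' : Fin (k + 1) → V), (∀ i, T i - φ a i • T 0 = T' i - φ a i • T' 0) →
      (fun i => T i + φ a i • (T' 0 - T 0)) = T' := by
    intro T T' h
    funext i
    rw [smul_sub, ← sub_eq_zero, ← sub_eq_zero.2 (h i)]
    abel
  refine Finset.sum_nbij' (fun x => (x.1.1, Fin.snoc x.1.2 (x.2.1 0 - x.1.1 0)))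
    (fun y => ((y.1, Fin.init y.2), (fun i => y.1 i + φ a i • y.2 (Fin.last a), Fin.init y.2)))
    ?_ ?_ ?_ ?_ ?_
  · rintro ⟨⟨T, h⟩, ⟨T', h'⟩⟩ hx
    simp only [Finset.mem_filter, Finset.mem_product, collapse, Prod.mk.injEq] at hx
    obtain ⟨⟨hx, hx'⟩, hT, rfl⟩ := hx
    rw [mem_cubeSet_snoc]
    refine ⟨hx, ?_⟩
    simp only
    rwa [htr T T' (congr_fun hT)]
  · rintro ⟨T, h⟩ hy
    rw [← Fin.snoc_init_self h, mem_cubeSet_snoc] at hy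
    simp only [Finset.mem_filter, Finset.mem_product, collapse, Prod.mk.injEq, and_true]
    refine ⟨hy, ?_⟩
    funext i
    simp [hφ]
  · rintro ⟨⟨T, h⟩, ⟨T', h'⟩⟩ hx
    simp only [Finset.mem_filter, Finset.mem_product, collapse, Prod.mk.injEq] at hx
    obtain ⟨⟨hx, hx'⟩, hT, rfl⟩ := hx
    simp [htr T T' (congr_fun hT)]
  · rintro ⟨T, h⟩ hy
    simp [hφ]
  · rintro ⟨⟨T, h⟩, ⟨T', h'⟩⟩ hx
    simp only [Finset.mem_filter, Finset.mem_product, collapse, Prod.mk.injEq] at hx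
    obtain ⟨⟨hx, hx'⟩, hT, rfl⟩ := hx
    simp only [cubeProd_snoc, htr T T' (congr_fun hT)]

/-- The collapsed cubes satisfy a system of the same kind for tuples that are shorter by one. -/
theorem card_image_collapse_le (hp2 : p ≠ 2) {B : LinearMap.BilinForm (ZMod p) V}
    (hsymm : ∀ x y, B x y = B y x) {k : ℕ} [DecidableEq V]
    (G : Fin (k + 1) → Fin (k + 1) → ZMod p) (hG : ∀ i j, G i j = G j i)
    (φ : ℕ → Fin (k + 1) → ZMod p) (hφ : ∀ b, φ b 0 = 1) (a : ℕ) :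
    ∃ (G' : Fin k → Fin k → ZMod p) (φ' : ℕ → Fin k → ZMod p), (∀ i j, G' i j = G' j i) ∧
      ((cubeSet B G φ a).image (collapse (φ a))).card ≤ (cubeEqs B G' φ' a).card := by
  refine ⟨fun i j => G i.succ j.succ - φ a i.succ * G 0 j.succ - φ a j.succ * G i.succ 0 +
    φ a i.succ * φ a j.succ * G 0 0, fun b i => φ b i.succ - φ a i.succ, fun i j => ?_, ?_⟩
  · beta_reduce
    rw [hG i.succ j.succ, hG 0 j.succ, hG i.succ 0]; ring
  refine Finset.card_le_card_of_injOn (fun x => (fun i => x.1 i.succ, x.2)) ?_ ?_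
  · intro y hy
    obtain ⟨⟨T, h⟩, hx, rfl⟩ := Finset.mem_image.1 (Finset.mem_coe.1 hy)
    rw [cubeSet_eq_cubeEqs hp2 hsymm G φ hφ, mem_cubeEqs] at hx
    obtain ⟨H0, H1, H2⟩ := hx
    simp only at H0 H1 H2
    rw [Finset.mem_coe, mem_cubeEqs]
    refine ⟨fun i j => ?_, fun i b => ?_, H2⟩
    · simp only [collapse, map_sub, map_smul, LinearMap.sub_apply, LinearMap.smul_apply,
        smul_eq_mul, H0]
      ring
    · simp only [collapse, map_sub, map_smul, LinearMap.sub_apply, LinearMap.smul_apply,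
        smul_eq_mul]
      have h0 := H1 0 b
      have h1 := H1 i.succ b
      rw [hφ] at h0
      linear_combination h1 - φ a i.succ * h0
  · rintro y hy y' hy' hyy
    obtain ⟨⟨T, h⟩, hx, rfl⟩ := Finset.mem_image.1 (Finset.mem_coe.1 hy)
    obtain ⟨⟨T', h'⟩, hx', rfl⟩ := Finset.mem_image.1 (Finset.mem_coe.1 hy')
    simp only [collapse, Prod.mk.injEq] at hyy ⊢
    refine ⟨?_, hyy.2⟩
    funext i
    refine Fin.cases ?_ (fun j => ?_) i
    · simp [hφ]
    · exact congr_fun hyy.1 j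

end

/-! ### Passing from Gram configurations to cubes on the sphere -/

section

theorem two_mul_succ_choose_two (n : ℕ) : 2 * (n + 1).choose 2 = (n + 1) * n := by
  rw [Nat.choose_two_right, Nat.add_sub_cancel, Nat.mul_div_cancel']
  rw [mul_comm]
  exact (Nat.even_mul_succ_self n).two_dvd

theorem succ_choose_two (n : ℕ) : (n + 1).choose 2 = n + n.choose 2 := by
  rw [Nat.choose_succ_succ' n 1, Nat.choose_one_right]

/-- The equation counts for which the loss in Cauchy–Schwarz is only `1 + O(p ^ (-1/2))`. -/
theorem eqCount_add_eqCount (k a : ℕ) :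
    eqCount k a + eqCount (k + 1) (a + 1) = eqCount (k + 1) a + eqCount (k + 1) a := by
  simp only [eqCount, succ_choose_two]
  ring

theorem eqCount_mono {n n' a a' : ℕ} (hn : n ≤ n') (ha : a ≤ a') :
    eqCount n a ≤ eqCount n' a' := by
  unfold eqCount
  gcongr

/-- Twice the number of equations for `cubeSet s`, compared with the assumed dimension. -/
theorem two_mul_eqCount (k s : ℕ) :
    2 * eqCount (k + 1) s + 2 * s = (k + s + 2) * (k + s + 1) := by
  have h1 := two_mul_succ_choose_two (k + 1)
  have h2 := two_mul_succ_choose_two s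
  rw [succ_choose_two] at h2
  unfold eqCount
  linear_combination h1 + h2

theorem eqCount_split (k s : ℕ) :
    eqCount (k + 1) s = eqCount 1 s + ((k + 1).choose 2 + k * (s + 1)) := by
  simp only [eqCount, succ_choose_two]
  simp
  ring

/-- The expected number of solutions of `cubeEqs` in a space of cardinality `p ^ d`. -/
noncomputable def mainTerm (p d n a : ℕ) : ℝ := (p : ℝ) ^ (d * (n + a)) / (p : ℝ) ^ eqCount n a

theorem mainTerm_pos {p : ℕ} (hp : 0 < p) (d n a : ℕ) : 0 < mainTerm p d n a := by
  have : (0 : ℝ) < p := by exact_mod_cast hp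
  unfold mainTerm
  positivity

theorem mainTerm_mul_mainTerm {p : ℕ} (hp : 0 < p) (d k a : ℕ) :
    mainTerm p d k a * mainTerm p d (k + 1) (a + 1) = mainTerm p d (k + 1) a ^ 2 := by
  have : (p : ℝ) ≠ 0 := by exact_mod_cast hp.ne'
  unfold mainTerm
  rw [div_mul_div_comm, ← pow_add, ← pow_add, eqCount_add_eqCount, div_pow, ← pow_mul, ← pow_mul]
  congr 2 <;> ring

theorem mainTerm_split {p : ℕ} (hp : 0 < p) (d k s : ℕ) :
    mainTerm p d (k + 1) s =
      mainTerm p d 1 s * ((p : ℝ) ^ (d * k) / (p : ℝ) ^ ((k + 1).choose 2 + k * (s + 1))) := by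
  have : (p : ℝ) ≠ 0 := by exact_mod_cast hp.ne'
  unfold mainTerm
  rw [eqCount_split, div_mul_div_comm, ← pow_add, ← pow_add]
  congr 2
  ring

/-- In dimension `d ≥ 2 e + 1` the Fourier bound beats the density `p ^ (-e)` of `e` equations. -/
theorem inv_sqrt_pow_le {p d e : ℕ} (hp : 1 ≤ p) (h : 2 * e + 1 ≤ d) :
    1 / √((p : ℝ) ^ d) ≤ 1 / (p : ℝ) ^ e * (1 / √p) := by
  have hp' : (1 : ℝ) ≤ p := by exact_mod_cast hp
  rw [div_mul_div_comm, one_mul]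
  apply one_div_le_one_div_of_le
  · positivity
  · apply Real.le_sqrt_of_sq_le
    rw [mul_pow, Real.sq_sqrt (by positivity), ← pow_mul, ← pow_succ]
    exact pow_le_pow_right₀ hp' (by omega)

/-- For odd `p` the relative counting error `1 / √p` stays away from `1`, so that one can divide by
the cardinalities. -/
theorem inv_sqrt_le {p : ℕ} (hp : 3 ≤ p) : 1 / √(p : ℝ) ≤ 0.58 := by
  have hp' : (3 : ℝ) ≤ p := by exact_mod_cast hp
  rw [div_le_iff₀ (by positivity)]
  have : (1.73 : ℝ) ≤ √p := Real.le_sqrt_of_sq_le (by norm_num; linarith)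
  nlinarith

variable {p d : ℕ} [Fact p.Prime] {V : Type*} [AddCommGroup V] [Module (ZMod p) V] [Fintype V]

theorem abs_card_cubeEqs_sub_le_mainTerm (hp2 : p ≠ 2)
    (hV : Fintype.card V = p ^ d) (B : LinearMap.BilinForm (ZMod p) V)
    (hsymm : ∀ x y, B x y = B y x) (hB : ∀ y, (∀ x, B x y = 0) → y = 0) {n : ℕ}
    (G : Fin n → Fin n → ZMod p) (hG : ∀ i j, G i j = G j i) (φ : ℕ → Fin n → ZMod p) (a : ℕ)
    (hd : 2 * eqCount n a + 1 ≤ d) :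
    |((cubeEqs B G φ a).card : ℝ) - mainTerm p d n a| ≤ mainTerm p d n a * (1 / √p) := by
  refine (abs_card_cubeEqs_sub_le hp2 hV B hsymm hB G hG φ a).trans ?_
  have := inv_sqrt_pow_le (Fact.out : p.Prime).one_le hd
  unfold mainTerm
  rw [div_eq_mul_one_div, div_eq_mul_one_div _ ((p : ℝ) ^ eqCount n a), mul_assoc]
  gcongr

/-- The Cauchy–Schwarz step for averages. -/
theorem norm_expect_cubeProd_sq_le (hp2 : p ≠ 2)
    (hV : Fintype.card V = p ^ d) (B : LinearMap.BilinForm (ZMod p) V)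
    (hsymm : ∀ x y, B x y = B y x) (hB : ∀ y, (∀ x, B x y = 0) → y = 0) {k : ℕ}
    (G : Fin (k + 1) → Fin (k + 1) → ZMod p) (hG : ∀ i j, G i j = G j i)
    (φ : ℕ → Fin (k + 1) → ZMod p) (hφ : ∀ b, φ b 0 = 1) (a : ℕ)
    (hd : 2 * eqCount (k + 1) (a + 1) + 1 ≤ d) (F₁ F₂ : (Fin (k + 1) → V) → ℂ)
    (hinv : ∀ T u, F₁ (fun i => T i + φ a i • u) = F₁ T) (hF₁ : ∀ T ∈ gramSet B G, ‖F₁ T‖ ≤ 1)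
    (hF₂ : ∀ T ∈ gramSet B G, ‖F₂ T‖ ≤ 1) :
    ‖(cubeSet B G φ a).expect (cubeProd φ a fun T => F₁ T * F₂ T)‖ ^ 2 ≤
      ‖(cubeSet B G φ (a + 1)).expect (cubeProd φ (a + 1) F₂)‖ + 24 * (1 / √p) := by
  classical
  have hp := (Fact.out : p.Prime).pos
  have hp3 : 3 ≤ p := by
    have := (Fact.out : p.Prime).two_le
    omega
  have hδ := inv_sqrt_le hp3
  set δ : ℝ := 1 / √p with hδdef
  have hδ0 : 0 ≤ δ := by positivity
  have ha := eqCount_mono (le_refl (k + 1)) (show a ≤ a + 1 by omega)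
  have hk := eqCount_mono (show k ≤ k + 1 by omega) (show a ≤ a + 1 by omega)
  have hS := abs_card_cubeEqs_sub_le_mainTerm hp2 hV B hsymm hB G hG φ a (by omega)
  have hS' := abs_card_cubeEqs_sub_le_mainTerm hp2 hV B hsymm hB G hG φ (a + 1) hd
  obtain ⟨G', φ', hG', hcard⟩ := card_image_collapse_le hp2 hsymm G hG φ hφ a
  have hI := abs_card_cubeEqs_sub_le_mainTerm hp2 hV B hsymm hB G' hG' φ' a (by omega)
  rw [← cubeSet_eq_cubeEqs hp2 hsymm G φ hφ] at hS hS'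
  have hM := mainTerm_pos hp d (k + 1) a
  have hM' := mainTerm_pos hp d (k + 1) (a + 1)
  have hMk := mainTerm_pos hp d k a
  have hMM := mainTerm_mul_mainTerm hp d k a
  have hcs := norm_sum_cubeProd_sq_le B G φ hφ a F₁ F₂ hinv hF₁
  have hcard' : (((cubeSet B G φ a).image (collapse (φ a))).card : ℝ) ≤
      (cubeEqs B G' φ' a).card := by exact_mod_cast hcard
  set N : ℝ := ((cubeSet B G φ a).card : ℝ)
  set N' : ℝ := ((cubeSet B G φ (a + 1)).card : ℝ)
  set I : ℝ := (((cubeSet B G φ a).image (collapse (φ a))).card : ℝ)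
  set M := mainTerm p d (k + 1) a
  set M' := mainTerm p d (k + 1) (a + 1)
  set Mk := mainTerm p d k a
  rw [Finset.expect_eq_sum_div_card, Finset.expect_eq_sum_div_card, norm_div, norm_div,
    RCLike.norm_natCast, RCLike.norm_natCast]
  change (_ / N) ^ 2 ≤ _ / N' + _
  rw [abs_le] at hS hS' hI
  have hN : M * (1 - δ) ≤ N := by linarith [hS.1]
  have hN0 : 0 < N := lt_of_lt_of_le (mul_pos hM (by linarith)) hN
  have hN' : N' ≤ M' * (1 + δ) := by linarith [hS'.2]
  have hN'0 : 0 < N' := lt_of_lt_of_le (mul_pos hM' (by linarith)) (by linarith [hS'.1] :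
    M' * (1 - δ) ≤ N')
  have hI' : I ≤ Mk * (1 + δ) := by linarith [hI.2]
  have hI0 : 0 ≤ I := Nat.cast_nonneg _
  set u := ‖∑ x ∈ cubeSet B G φ (a + 1), cubeProd φ (a + 1) F₂ x‖ with hu
  have hu1 : u / N' ≤ 1 := by
    rw [div_le_one hN'0]
    refine (norm_sum_le_of_le (f := cubeProd φ (a + 1) F₂) (n := fun _ => 1) _ fun x hx =>
      norm_cubeProd_le_one _ _ _ _ fun ε => hF₂ _ (mem_cubeSet.1 hx ε)).trans ?_
    simp [N']
  have hratio : I * N' ≤ N ^ 2 * (1 + 24 * δ) := by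
    have h1 : I * N' ≤ M ^ 2 * (1 + δ) ^ 2 := by
      calc I * N' ≤ (Mk * (1 + δ)) * (M' * (1 + δ)) := by gcongr
        _ = M ^ 2 * (1 + δ) ^ 2 := by rw [← hMM]; ring
    have h2 : M ^ 2 * (1 - δ) ^ 2 ≤ N ^ 2 := by
      rw [← mul_pow]
      exact pow_le_pow_left₀ (mul_nonneg hM.le (by linarith)) hN 2
    -- `4 / 0.42 ^ 2 < 24`
    have h3 : (1 + δ) ^ 2 ≤ (1 - δ) ^ 2 * (1 + 24 * δ) := by
      nlinarith [mul_nonneg hδ0 (sub_nonneg.2 hδ), mul_nonneg hδ0 (mul_nonneg hδ0 hδ0)]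
    calc I * N' ≤ M ^ 2 * (1 + δ) ^ 2 := h1
      _ ≤ M ^ 2 * ((1 - δ) ^ 2 * (1 + 24 * δ)) := by gcongr
      _ = M ^ 2 * (1 - δ) ^ 2 * (1 + 24 * δ) := by ring
      _ ≤ _ := by gcongr
  calc (‖∑ x ∈ cubeSet B G φ a, cubeProd φ a (fun T => F₁ T * F₂ T) x‖ / N) ^ 2
      = ‖∑ x ∈ cubeSet B G φ a, cubeProd φ a (fun T => F₁ T * F₂ T) x‖ ^ 2 / N ^ 2 := div_pow _ _ _
    _ ≤ I * u / N ^ 2 := by gcongr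
    _ = I * N' * (u / N') / N ^ 2 := by field_simp
    _ ≤ N ^ 2 * (1 + 24 * δ) * (u / N') / N ^ 2 := by gcongr
    _ = u / N' + 24 * δ * (u / N') := by field_simp
    _ ≤ u / N' + 24 * δ * 1 := by gcongr
    _ = _ := by rw [mul_one]

/-- Iterating the Cauchy–Schwarz step removes all factors `Fs b`, `b < s`. The additional
factors `Fs b`, `s ≤ b < s + m`, make the induction on `s` work. -/
theorem norm_expect_pow_le (s : ℕ) : ∃ K : ℝ, 0 ≤ K ∧ ∀ {p d : ℕ} [Fact p.Prime] {V : Type}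
    [AddCommGroup V] [Module (ZMod p) V] [Fintype V], p ≠ 2 →
    Fintype.card V = p ^ d → ∀ (B : LinearMap.BilinForm (ZMod p) V),
    (∀ x y, B x y = B y x) → (∀ y, (∀ x, B x y = 0) → y = 0) → ∀ {k : ℕ}
    (G : Fin (k + 1) → Fin (k + 1) → ZMod p), (∀ i j, G i j = G j i) →
    ∀ (φ : ℕ → Fin (k + 1) → ZMod p), (∀ b, φ b 0 = 1) →
    2 * eqCount (k + 1) s + 1 ≤ d →
    ∀ (Fs : ℕ → (Fin (k + 1) → V) → ℂ) (F : (Fin (k + 1) → V) → ℂ),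
    (∀ b T u, Fs b (fun i => T i + φ b i • u) = Fs b T) →
    (∀ b, ∀ T ∈ gramSet B G, ‖Fs b T‖ ≤ 1) → (∀ T ∈ gramSet B G, ‖F T‖ ≤ 1) →
    ∀ m, ‖(gramSet B G).expect fun T => (∏ b ∈ Finset.Ico 0 (s + m), Fs b T) * F T‖ ^ 2 ^ s ≤
      ‖(cubeSet B G φ s).expect
        (cubeProd φ s fun T => (∏ b ∈ Finset.Ico s (s + m), Fs b T) * F T)‖ + K * (1 / √p) := by
  induction s with
  | zero =>
    refine ⟨0, le_rfl, ?_⟩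
    intro p d _ V _ _ _ hp2 hV B hsymm hB k G hG φ hφ hd Fs F hinv hFs hF m
    rw [pow_zero, pow_one, zero_mul, add_zero]
    have hempty : ∀ (T : Fin (k + 1) → V) (h : Fin 0 → V), cubePt φ T h ∅ = T := by
      intro T h; funext i; simp [cubePt]
    refine le_of_eq (congrArg _ ?_)
    refine Finset.expect_nbij' (fun T => (T, Fin.elim0)) (fun x => x.1) ?_ ?_ ?_ ?_ ?_
    · intro T hT
      rw [mem_cubeSet]
      intro ε
      rw [Finset.eq_empty_of_isEmpty ε]
      simpa only [hempty] using hT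
    · intro x hx
      simpa only [hempty] using mem_cubeSet.1 hx ∅
    · intro T _; rfl
    · intro x _
      exact Prod.ext rfl (Subsingleton.elim _ _)
    · intro T _
      rw [cubeProd, Fintype.prod_subsingleton _ ∅, hempty, zero_add]
      rfl
  | succ s ih =>
    obtain ⟨K, hK, ih⟩ := ih
    refine ⟨24 + 2 * K + K ^ 2, by positivity, ?_⟩
    intro p d _ V _ _ _ hp2 hV B hsymm hB k G hG φ hφ hd Fs F hinv hFs hF m
    have hmono := eqCount_mono (le_refl (k + 1)) (show s ≤ s + 1 by omega)
    have h1 := ih hp2 hV B hsymm hB G hG φ hφ (by omega) Fs F hinv hFs hF (m + 1)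
    have hprod : ∀ a, ∀ T ∈ gramSet B G, ‖(∏ b ∈ Finset.Ico a (s + (m + 1)), Fs b T) * F T‖ ≤ 1 := by
      intro a T hT
      rw [norm_mul, norm_prod]
      exact mul_le_one₀ (Finset.prod_le_one (fun _ _ => norm_nonneg _) fun b _ => hFs b T hT)
        (norm_nonneg _) (hF T hT)
    have h2 := norm_expect_cubeProd_sq_le hp2 hV B hsymm hB G hG φ hφ s hd (Fs s)
      (fun T => (∏ b ∈ Finset.Ico (s + 1) (s + (m + 1)), Fs b T) * F T) (hinv s) (hFs s)
      (hprod _)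
    have hsplit : (fun T => Fs s T * ((∏ b ∈ Finset.Ico (s + 1) (s + (m + 1)), Fs b T) * F T)) =
        fun T => (∏ b ∈ Finset.Ico s (s + (m + 1)), Fs b T) * F T := by
      funext T
      rw [Finset.prod_eq_prod_Ico_succ_bot (show s < s + (m + 1) by omega), mul_assoc]
    rw [hsplit] at h2
    rw [show s + 1 + m = s + (m + 1) by ring]
    have hδ0 : (0 : ℝ) ≤ 1 / √p := by positivity
    have hδ1 : 1 / √(p : ℝ) ≤ 1 := by
      rw [div_le_one₀ (by have := (Fact.out : p.Prime).pos; positivity)]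
      exact Real.one_le_sqrt.2 (by exact_mod_cast (Fact.out : p.Prime).one_le)
    set δ : ℝ := 1 / √p
    set v := ‖(cubeSet B G φ s).expect
        (cubeProd φ s fun T => (∏ b ∈ Finset.Ico s (s + (m + 1)), Fs b T) * F T)‖ with hv
    have hv1 : v ≤ 1 := by
      rw [hv, Finset.expect_eq_sum_div_card, norm_div, RCLike.norm_natCast]
      refine div_le_one_of_le₀ ?_ (Nat.cast_nonneg _)
      refine (norm_sum_le_of_le (n := fun _ => 1) _ fun x hx =>
        norm_cubeProd_le_one _ _ _ _ fun ε => hprod s _ (mem_cubeSet.1 hx ε)).trans ?_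
      simp
    have hv0 : 0 ≤ v := norm_nonneg _
    rw [pow_succ 2 s, pow_mul]
    refine (pow_le_pow_left₀ (by positivity) h1 2).trans ?_
    have h3 : (v + K * δ) ^ 2 ≤ v ^ 2 + (2 * K + K ^ 2) * δ := by
      have h4 : v * (K * δ) ≤ 1 * (K * δ) := by gcongr
      have h5 : K ^ 2 * (δ * δ) ≤ K ^ 2 * (δ * 1) := by gcongr
      nlinarith
    linarith

end

/-! ### Equidistribution of cubes over the Gowers set of the sphere -/

section

variable {p d : ℕ} [Fact p.Prime] {V : Type*} [AddCommGroup V] [Module (ZMod p) V] [Fintype V]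

/-- The cubes all of whose vertices lie on the sphere `B x x = r`. -/
noncomputable def sphereBox (B : LinearMap.BilinForm (ZMod p) V) (r : ZMod p) (s : ℕ) :
    Finset (V × (Fin s → V)) :=
  open scoped Classical in
  Finset.univ.filter fun x => ∀ ε : Finset (Fin s),
    B (x.1 + ∑ i ∈ ε, x.2 i) (x.1 + ∑ i ∈ ε, x.2 i) = r

theorem mem_sphereBox {B : LinearMap.BilinForm (ZMod p) V} {r : ZMod p} {s : ℕ}
    {x : V × (Fin s → V)} : x ∈ sphereBox B r s ↔ ∀ ε : Finset (Fin s),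
      B (x.1 + ∑ i ∈ ε, x.2 i) (x.1 + ∑ i ∈ ε, x.2 i) = r := by
  simp [sphereBox]

theorem mem_sphereBox_iff_cubeSet {B : LinearMap.BilinForm (ZMod p) V} {r : ZMod p} {s : ℕ}
    {n : V} {h : Fin s → V} : (n, h) ∈ sphereBox B r s ↔
      ((fun _ => n, h) : (Fin 1 → V) × (Fin s → V)) ∈
        cubeSet B (fun _ _ => r) (fun _ _ => 1) s := by
  simp [mem_sphereBox, mem_cubeSet, mem_gramSet, cubePt]

theorem card_sphereBox (B : LinearMap.BilinForm (ZMod p) V) (r : ZMod p) (s : ℕ) :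
    (sphereBox B r s).card =
      (cubeSet B (fun _ _ : Fin 1 => r) (fun _ _ => 1) s).card := by
  have hx : ∀ T : Fin 1 → V, (fun _ => T 0) = T := fun T => by
    funext i; rw [Subsingleton.elim i 0]
  refine Finset.card_nbij' (fun x => (fun _ => x.1, x.2)) (fun y => (y.1 0, y.2)) ?_ ?_ ?_ ?_
  · rintro ⟨n, h⟩ hx
    exact mem_sphereBox_iff_cubeSet.1 hx
  · rintro ⟨T, h⟩ hy
    refine mem_sphereBox_iff_cubeSet.2 ?_
    simpa only [hx] using Finset.mem_coe.1 hy
  · intro x _; rfl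
  · rintro ⟨T, h⟩ _
    simp only [hx]

/-- The completions of a cube `x` on the sphere to a cube of tuples with Gram matrix `G`. -/
noncomputable def boxFibre (B : LinearMap.BilinForm (ZMod p) V) {k : ℕ}
    (G : Fin (k + 1) → Fin (k + 1) → ZMod p) (φ : ℕ → Fin (k + 1) → ZMod p) {s : ℕ}
    (x : V × (Fin s → V)) : Finset (Fin k → V) :=
  open scoped Classical in
  Finset.univ.filter fun t => ((Fin.cons x.1 t, x.2) : (Fin (k + 1) → V) × (Fin s → V)) ∈
    cubeSet B G φ s

theorem sum_cubeSet_eq_sum_sphereBox (B : LinearMap.BilinForm (ZMod p) V) {k : ℕ}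
    (G : Fin (k + 1) → Fin (k + 1) → ZMod p) (φ : ℕ → Fin (k + 1) → ZMod p)
    (hφ : ∀ b, φ b 0 = 1) (s : ℕ) (g : V × (Fin s → V) → ℂ) :
    ∑ x ∈ cubeSet B G φ s, g (x.1 0, x.2) =
      ∑ y ∈ sphereBox B (G 0 0) s, ((boxFibre B G φ y).card : ℂ) * g y := by
  classical
  rw [← Finset.sum_fiberwise_of_maps_to
    (g := fun x : (Fin (k + 1) → V) × (Fin s → V) => (x.1 0, x.2)) (t := sphereBox B (G 0 0) s)]
  · refine Finset.sum_congr rfl fun y _ => ?_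
    rw [Finset.sum_congr rfl (g := fun _ => g y) (fun x hx => by rw [(Finset.mem_filter.1 hx).2]),
      Finset.sum_const, nsmul_eq_mul]
    congr 2
    refine Finset.card_nbij' (fun x => Fin.tail x.1) (fun t => (Fin.cons y.1 t, y.2)) ?_ ?_ ?_ ?_
    · rintro ⟨T, h⟩ hx
      obtain ⟨hx, rfl⟩ := Finset.mem_filter.1 (Finset.mem_coe.1 hx)
      simpa [boxFibre] using hx
    · intro t ht
      simpa [boxFibre] using ht
    · rintro ⟨T, h⟩ hx
      obtain ⟨hx, rfl⟩ := Finset.mem_filter.1 (Finset.mem_coe.1 hx)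
      simp
    · intro t _
      simp
  · rintro ⟨T, h⟩ hx
    rw [mem_sphereBox]
    intro ε
    have := mem_gramSet.1 (mem_cubeSet.1 hx ε) 0 0
    simpa only [cubePt_zero hφ] using this

/-- Over a linearly independent cube all fibres have nearly the same size. -/
theorem abs_card_boxFibre_sub_le (hp2 : p ≠ 2)
    (hV : Fintype.card V = p ^ d) (B : LinearMap.BilinForm (ZMod p) V)
    (hsymm : ∀ x y, B x y = B y x) (hB : ∀ y, (∀ x, B x y = 0) → y = 0) {k : ℕ}
    (G : Fin (k + 1) → Fin (k + 1) → ZMod p) (hG : ∀ i j, G i j = G j i)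
    (φ : ℕ → Fin (k + 1) → ZMod p) (hφ : ∀ b, φ b 0 = 1) {s : ℕ} (y : V × (Fin s → V))
    (hy : y ∈ sphereBox B (G 0 0) s)
    (hli : LinearIndependent (ZMod p) (Fin.cons y.1 y.2 : Fin (s + 1) → V)) :
    |((boxFibre B G φ y).card : ℝ) -
      (p : ℝ) ^ (d * k) / (p : ℝ) ^ ((k + 1).choose 2 + k * (s + 1))| ≤
      (p : ℝ) ^ (d * k) / √((p : ℝ) ^ d) := by
  obtain ⟨n, h⟩ := y
  refine abs_card_gram_fibre_sub_le hp2 hV B hsymm hB (fun i j => G i.succ j.succ)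
    (fun i j => hG _ _) _ hli
    (fun i => Fin.cons (G i.succ 0) fun b => -(φ b i.succ / 2 * B (h b) (h b))) _ fun t => ?_
  rw [mem_sphereBox_iff_cubeSet, cubeSet_eq_cubeEqs hp2 hsymm _ _ (fun _ => rfl), mem_cubeEqs] at hy
  obtain ⟨hn, hnh, hhh⟩ := hy
  simp only [boxFibre, Finset.mem_filter, Finset.mem_univ, true_and,
    cubeSet_eq_cubeEqs hp2 hsymm G φ hφ, mem_cubeEqs, Fin.forall_fin_succ, Fin.cons_zero,
    Fin.cons_succ]
  have h00 := hn 0 0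
  constructor
  · rintro ⟨⟨_, H0⟩, ⟨_, H1⟩, _⟩
    exact ⟨fun i => (H0 i).2, fun i => ⟨(H0 i).1, fun b => eq_neg_of_add_eq_zero_left (H1 i b)⟩⟩
  · rintro ⟨H0, H1⟩
    refine ⟨⟨⟨h00, fun j => ?_⟩, fun i => ⟨(H1 i).1, H0 i⟩⟩, ⟨fun b => ?_, fun i b => ?_⟩, hhh⟩
    · rw [hsymm, hG]; exact (H1 j).1
    · rw [hφ]; exact hnh 0 b
    · rw [(H1 i).2 b]; ring

theorem card_boxFibre_le (hV : Fintype.card V = p ^ d) (B : LinearMap.BilinForm (ZMod p) V) {k : ℕ}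
    (G : Fin (k + 1) → Fin (k + 1) → ZMod p)
    (φ : ℕ → Fin (k + 1) → ZMod p) {s : ℕ} (y : V × (Fin s → V)) :
    ((boxFibre B G φ y).card : ℝ) ≤ (p : ℝ) ^ (d * k) := by
  have := Finset.card_le_univ (boxFibre B G φ y)
  rw [Fintype.card_fun, hV, Fintype.card_fin, ← pow_mul] at this
  exact_mod_cast this

/-- Sums over tuple cubes of a function of the first entry are, up to a small error, a constant
multiple of sums over cubes on the sphere: independent cubes have almost equal fibres, and
dependent ones are negligible. -/
theorem norm_sum_cubeSet_sub_le (hp2 : p ≠ 2)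
    (hV : Fintype.card V = p ^ d) (B : LinearMap.BilinForm (ZMod p) V)
    (hsymm : ∀ x y, B x y = B y x) (hB : ∀ y, (∀ x, B x y = 0) → y = 0) {k : ℕ}
    (G : Fin (k + 1) → Fin (k + 1) → ZMod p) (hG : ∀ i j, G i j = G j i)
    (φ : ℕ → Fin (k + 1) → ZMod p) (hφ : ∀ b, φ b 0 = 1) {s : ℕ}
    (g : V × (Fin s → V) → ℂ) (hg : ∀ y ∈ sphereBox B (G 0 0) s, ‖g y‖ ≤ 1) :
    ‖∑ x ∈ cubeSet B G φ s, g (x.1 0, x.2) -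
      (((p : ℝ) ^ (d * k) / (p : ℝ) ^ ((k + 1).choose 2 + k * (s + 1)) : ℝ) : ℂ) *
        ∑ y ∈ sphereBox B (G 0 0) s, g y‖ ≤
      (sphereBox B (G 0 0) s).card * ((p : ℝ) ^ (d * k) / √((p : ℝ) ^ d)) +
        (p : ℝ) ^ (s + 1 + d * s) * (p : ℝ) ^ (d * k) := by
  classical
  have hp1 : (1 : ℝ) ≤ p := by exact_mod_cast (Fact.out : p.Prime).one_le
  set w : ℝ := (p : ℝ) ^ (d * k) / (p : ℝ) ^ ((k + 1).choose 2 + k * (s + 1)) with hw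
  have hw0 : 0 ≤ w := by positivity
  have hw1 : w ≤ (p : ℝ) ^ (d * k) := div_le_self (by positivity) (one_le_pow₀ hp1)
  rw [sum_cubeSet_eq_sum_sphereBox B G φ hφ, Finset.mul_sum, ← Finset.sum_sub_distrib]
  let D := (sphereBox B (G 0 0) s).filter fun y =>
    ¬ LinearIndependent (ZMod p) (Fin.cons y.1 y.2 : Fin (s + 1) → V)
  have hD : (D.card : ℝ) ≤ (p : ℝ) ^ (s + 1 + d * s) := by
    have h1 : D.card = (D.image fun y => (Fin.cons y.1 y.2 : Fin (s + 1) → V)).card := by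
      refine (Finset.card_image_of_injective _ ?_).symm
      rintro ⟨n, h⟩ ⟨n', h'⟩ hh
      have := Fin.cons_injective2 hh
      exact Prod.ext this.1 this.2
    have h2 := card_dependent_le (p := p) hV
      (D.image fun y => (Fin.cons y.1 y.2 : Fin (s + 1) → V)) ?_
    · rw [← h1] at h2
      exact_mod_cast h2
    · intro v hv
      obtain ⟨y, hy, rfl⟩ := Finset.mem_image.1 hv
      exact (Finset.mem_filter.1 hy).2
  have hterm : ∀ y ∈ sphereBox B (G 0 0) s,
      ‖((boxFibre B G φ y).card : ℂ) * g y - (w : ℂ) * g y‖ ≤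
        (p : ℝ) ^ (d * k) / √((p : ℝ) ^ d) + if y ∈ D then (p : ℝ) ^ (d * k) else 0 := by
    intro y hy
    have h1 : ((boxFibre B G φ y).card : ℂ) * g y - (w : ℂ) * g y =
        (((boxFibre B G φ y).card - w : ℝ) : ℂ) * g y := by push_cast; ring
    rw [h1, norm_mul, Complex.norm_real, Real.norm_eq_abs]
    refine (mul_le_of_le_one_right (abs_nonneg _) (hg y hy)).trans ?_
    have h0 : 0 ≤ (p : ℝ) ^ (d * k) / √((p : ℝ) ^ d) := by positivity
    split_ifs with hyD
    · have h2 := card_boxFibre_le hV B G φ y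
      have h3 : (0 : ℝ) ≤ (boxFibre B G φ y).card := Nat.cast_nonneg _
      rw [abs_le]
      constructor <;> linarith
    · rw [add_zero]
      refine abs_card_boxFibre_sub_le hp2 hV B hsymm hB G hG φ hφ y hy ?_
      by_contra hli
      exact hyD (Finset.mem_filter.2 ⟨hy, hli⟩)
  refine (norm_sum_le_of_le _ hterm).trans ?_
  rw [Finset.sum_add_distrib, Finset.sum_const, nsmul_eq_mul, Finset.sum_ite_mem, Finset.sum_const,
    nsmul_eq_mul]
  have : ((sphereBox B (G 0 0) s ∩ D).card : ℝ) ≤ (p : ℝ) ^ (s + 1 + d * s) :=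
    le_trans (by exact_mod_cast Finset.card_le_card Finset.inter_subset_right) hD
  gcongr

/-- Averages over tuple cubes of a function of the first entry are, up to `O(p ^ (-1/2))`, averages
over cubes on the sphere. -/
theorem norm_expect_cubeSet_sub_le (hp2 : p ≠ 2)
    (hV : Fintype.card V = p ^ d) (B : LinearMap.BilinForm (ZMod p) V)
    (hsymm : ∀ x y, B x y = B y x) (hB : ∀ y, (∀ x, B x y = 0) → y = 0) {k : ℕ}
    (G : Fin (k + 1) → Fin (k + 1) → ZMod p) (hG : ∀ i j, G i j = G j i)
    (φ : ℕ → Fin (k + 1) → ZMod p) (hφ : ∀ b, φ b 0 = 1) {s : ℕ}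
    (hd : 2 * eqCount (k + 1) s + 2 * s + 1 ≤ d)
    (g : V × (Fin s → V) → ℂ) (hg : ∀ y ∈ sphereBox B (G 0 0) s, ‖g y‖ ≤ 1) :
    ‖((cubeSet B G φ s).expect fun x => g (x.1 0, x.2)) - (sphereBox B (G 0 0) s).expect g‖ ≤
      16 * (1 / √p) := by
  have hp := (Fact.out : p.Prime).pos
  have hp3 : 3 ≤ p := by
    have := (Fact.out : p.Prime).two_le
    omega
  have hp1 : (1 : ℝ) ≤ p := by exact_mod_cast hp
  have he1 : 1 ≤ eqCount (k + 1) s := by simp only [eqCount, succ_choose_two]; omega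
  have hsplit := eqCount_split k s
  have hδ := inv_sqrt_le hp3
  have hS := abs_card_cubeEqs_sub_le_mainTerm hp2 hV B hsymm hB G hG φ s (by omega)
  have hX := abs_card_cubeEqs_sub_le_mainTerm hp2 hV B hsymm hB (fun _ _ : Fin 1 => G 0 0)
    (fun _ _ => rfl) (fun _ _ => 1) s (by omega)
  rw [← cubeSet_eq_cubeEqs hp2 hsymm _ _ (fun _ => rfl), ← card_sphereBox] at hX
  rw [← cubeSet_eq_cubeEqs hp2 hsymm G φ hφ] at hS
  have hsub := norm_sum_cubeSet_sub_le hp2 hV B hsymm hB G hG φ hφ g hg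
  have hsub1 := norm_sum_cubeSet_sub_le hp2 hV B hsymm hB G hG φ hφ (s := s) (fun _ => 1)
    (fun _ _ => by simp)
  have hMsplit := mainTerm_split hp d k s
  have hM := mainTerm_pos hp d (k + 1) s
  have hM1 := mainTerm_pos hp d 1 s
  have hrw := inv_sqrt_pow_le (p := p) (d := d) (e := (k + 1).choose 2 + k * (s + 1)) hp (by omega)
  have hdep : (p : ℝ) ^ (s + 1 + d * s) * (p : ℝ) ^ (d * k) ≤
      mainTerm p d (k + 1) s * (1 / √p) := by
    have h1 := inv_sqrt_pow_le (p := p) (d := 2 * d) (e := s + 1 + eqCount (k + 1) s) hp (by omega)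
    have h2 : √((p : ℝ) ^ (2 * d)) = (p : ℝ) ^ d := by
      rw [mul_comm, pow_mul, Real.sqrt_sq (by positivity)]
    rw [h2] at h1
    have h3 : (p : ℝ) ^ (s + 1 + d * s) * (p : ℝ) ^ (d * k) =
        (p : ℝ) ^ (d * (k + 1 + s)) * (p : ℝ) ^ (s + 1) * (1 / (p : ℝ) ^ d) := by
      field_simp
      ring
    rw [h3]
    calc _ ≤ (p : ℝ) ^ (d * (k + 1 + s)) * (p : ℝ) ^ (s + 1) *
          (1 / (p : ℝ) ^ (s + 1 + eqCount (k + 1) s) * (1 / √p)) := by gcongr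
      _ = _ := by
        unfold mainTerm
        rw [pow_add (p : ℝ) (s + 1)]
        field_simp
  set w : ℝ := (p : ℝ) ^ (d * k) / (p : ℝ) ^ ((k + 1).choose 2 + k * (s + 1)) with hw
  set δ : ℝ := 1 / √p with hδdef
  have hδ0 : 0 ≤ δ := by positivity
  set N : ℝ := ((cubeSet B G φ s).card : ℝ) with hN
  set X : ℝ := ((sphereBox B (G 0 0) s).card : ℝ) with hXdef
  set M := mainTerm p d (k + 1) s
  set M1 := mainTerm p d 1 s
  rw [abs_le] at hS hX
  -- `0.42 ≤ 1 - δ` and `1 + δ ≤ 1.58`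
  have hNM : M * 0.42 ≤ N := by nlinarith [hS.1]
  have hN0 : 0 < N := lt_of_lt_of_le (by positivity) hNM
  have hX0 : 0 < X := by nlinarith [hX.1]
  have hX2 : X ≤ M1 * 1.58 := by nlinarith [hX.2]
  have hη : X * ((p : ℝ) ^ (d * k) / √((p : ℝ) ^ d)) +
      (p : ℝ) ^ (s + 1 + d * s) * (p : ℝ) ^ (d * k) ≤ 8 * δ * N := by
    have h1 : (p : ℝ) ^ (d * k) / √((p : ℝ) ^ d) ≤ w * δ := by
      rw [hw, div_eq_mul_one_div, div_eq_mul_one_div _ ((p : ℝ) ^ _), mul_assoc]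
      gcongr
    calc _ ≤ M1 * 1.58 * (w * δ) + M * δ := by gcongr
      _ = 2.58 * (M * δ) := by rw [hMsplit]; ring
      _ ≤ 8 * δ * (M * 0.42) := by nlinarith [mul_nonneg hM.le hδ0]
      _ ≤ _ := by gcongr
  have hsub' := hsub.trans hη
  have hsub1' := hsub1.trans hη
  rw [Finset.expect_eq_sum_div_card, Finset.expect_eq_sum_div_card]
  set Sg := ∑ x ∈ cubeSet B G φ s, g (x.1 0, x.2)
  set Xg := ∑ y ∈ sphereBox B (G 0 0) s, g y
  have hXg : ‖Xg‖ ≤ X := by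
    refine (norm_sum_le_of_le _ hg).trans ?_
    simp [X]
  have hsub1'' : ‖(N : ℂ) - (w : ℂ) * X‖ ≤ 8 * δ * N := by
    simpa [N, X] using hsub1'
  have hNc : (N : ℂ) ≠ 0 := by exact_mod_cast hN0.ne'
  have hXc : (X : ℂ) ≠ 0 := by exact_mod_cast hX0.ne'
  have e1 : ((cubeSet B G φ s).card : ℂ) = (N : ℂ) := by simp [N]
  have e2 : ((sphereBox B (G 0 0) s).card : ℂ) = (X : ℂ) := by simp [X]
  rw [e1, e2]
  -- The error in the numerator and, by the case `g = 1`, the error in the normalization.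
  have key : Sg / N - Xg / X = (Sg - w * Xg) / N - Xg / X * ((N - w * X) / N) := by
    field_simp
    ring
  rw [key]
  have t1 : ‖(Sg - w * Xg) / N‖ ≤ 8 * δ := by
    rw [norm_div, Complex.norm_real, Real.norm_of_nonneg hN0.le, div_le_iff₀ hN0]
    exact hsub'
  have t2 : ‖((N : ℂ) - w * X) / N‖ ≤ 8 * δ := by
    rw [norm_div, Complex.norm_real, Real.norm_of_nonneg hN0.le, div_le_iff₀ hN0]
    exact hsub1''
  have t3 : ‖Xg / X‖ ≤ 1 := by
    rw [norm_div, Complex.norm_real, Real.norm_of_nonneg hX0.le, div_le_one hX0]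
    exact hXg
  calc _ ≤ ‖(Sg - w * Xg) / N‖ + ‖Xg / X * ((N - w * X) / N)‖ := norm_sub_le _ _
    _ ≤ 8 * δ + 1 * (8 * δ) := by rw [norm_mul]; gcongr
    _ = _ := by ring

end

/-! ### The inequality for Gram configurations -/

/-- The generalized von Neumann inequality for Gram configurations: factors that are invariant in
one of the directions `φ b`, `b < s`, are dominated by the cube average of the remaining factor. -/
theorem norm_expect_gramSet_pow_le (s : ℕ) : ∃ K : ℝ, 0 ≤ K ∧ ∀ {p d : ℕ} [Fact p.Prime]
    {V : Type} [AddCommGroup V] [Module (ZMod p) V] [Fintype V], p ≠ 2 →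
    Fintype.card V = p ^ d → ∀ (B : LinearMap.BilinForm (ZMod p) V),
    (∀ x y, B x y = B y x) → (∀ y, (∀ x, B x y = 0) → y = 0) → ∀ {k : ℕ}
    (G : Fin (k + 1) → Fin (k + 1) → ZMod p), (∀ i j, G i j = G j i) →
    ∀ (φ : ℕ → Fin (k + 1) → ZMod p), (∀ b, φ b 0 = 1) →
    2 * eqCount (k + 1) s + 2 * s + 1 ≤ d →
    ∀ (Fs : ℕ → (Fin (k + 1) → V) → ℂ) (f : V → ℂ),
    (∀ b T u, Fs b (fun i => T i + φ b i • u) = Fs b T) →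
    (∀ b, ∀ T ∈ gramSet B G, ‖Fs b T‖ ≤ 1) → (∀ x, B x x = G 0 0 → ‖f x‖ ≤ 1) →
    ‖(gramSet B G).expect fun T => (∏ b ∈ Finset.range s, Fs b T) * f (T 0)‖ ^ 2 ^ s ≤
      ‖(sphereBox B (G 0 0) s).expect fun nh =>
        ∏ ε : Finset (Fin s), (starRingEnd ℂ)^[ε.card] (f (nh.1 + ∑ i ∈ ε, nh.2 i))‖ +
        K * (1 / √p) := by
  obtain ⟨K, hK, key⟩ := norm_expect_pow_le s
  refine ⟨K + 16, by positivity, ?_⟩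
  intro p d _ V _ _ _ hp2 hV B hsymm hB k G hG φ hφ hd Fs f hinv hFs hf
  have h1 := key hp2 hV B hsymm hB G hG φ hφ (by omega) Fs (fun T => f (T 0)) hinv hFs
    (fun T hT => hf _ (mem_gramSet.1 hT 0 0)) 0
  have h2 := norm_expect_cubeSet_sub_le hp2 hV B hsymm hB G hG φ hφ hd
    (fun nh => ∏ ε : Finset (Fin s), (starRingEnd ℂ)^[ε.card] (f (nh.1 + ∑ i ∈ ε, nh.2 i))) ?_
  · simp only [add_zero, Finset.Ico_self, Finset.prod_empty, one_mul] at h1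
    have h3 : (cubeProd φ s fun T : Fin (k + 1) → V => f (T 0)) = fun x =>
        ∏ ε : Finset (Fin s), (starRingEnd ℂ)^[ε.card] (f (x.1 0 + ∑ i ∈ ε, x.2 i)) := by
      funext x
      simp only [cubeProd, cubePt_zero hφ]
    rw [h3, ← Finset.range_eq_Ico] at h1
    have h4 := norm_le_norm_add_norm_sub' ((cubeSet B G φ s).expect fun x =>
        ∏ ε : Finset (Fin s), (starRingEnd ℂ)^[ε.card] (f (x.1 0 + ∑ i ∈ ε, x.2 i)))
      ((sphereBox B (G 0 0) s).expect fun nh =>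
        ∏ ε : Finset (Fin s), (starRingEnd ℂ)^[ε.card] (f (nh.1 + ∑ i ∈ ε, nh.2 i)))
    linarith
  · intro y hy
    rw [norm_prod]
    exact Finset.prod_le_one (fun _ _ => norm_nonneg _) fun ε _ => by
      rw [norm_iterate_conj]; exact hf _ (mem_sphereBox.1 hy ε)

/-! ### Coordinates on the almost congruent copies -/

/-- The symmetric bilinear form `x A y` with `quadForm A n = bilin A n n`. -/
noncomputable def bilin {p d : ℕ} [Fact p.Prime] (A : Matrix (Fin d) (Fin d) (ZMod p)) :
    LinearMap.BilinForm (ZMod p) (Fin d → ZMod p) :=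
  Matrix.toLinearMap₂' (ZMod p) A

section

variable {p d : ℕ} [Fact p.Prime] {A : Matrix (Fin d) (Fin d) (ZMod p)}

theorem quadForm_eq_bilin (n : Fin d → ZMod p) : quadForm A n = bilin A n n := by
  rw [quadForm, bilin, Matrix.toLinearMap₂'_apply', Matrix.dotProduct_mulVec]

theorem bilin_comm (hA : A.IsSymm) (x y : Fin d → ZMod p) : bilin A x y = bilin A y x := by
  rw [bilin, Matrix.toLinearMap₂'_apply', Matrix.toLinearMap₂'_apply', Matrix.dotProduct_mulVec,
    dotProduct_comm, ← Matrix.mulVec_transpose, hA.eq]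

theorem bilin_nondegenerate (hdet : A.det ≠ 0) (y : Fin d → ZMod p)
    (h : ∀ x, bilin A x y = 0) : y = 0 := by
  refine Matrix.eq_zero_of_mulVec_eq_zero hdet ?_
  ext i
  have := h (Pi.single i 1)
  rw [bilin, Matrix.toLinearMap₂'_apply'] at this
  simpa using this

theorem gowersSet_eq_sphereBox (r : ZMod p) (s : ℕ) :
    gowersSet A r s = sphereBox (bilin A) r s := by
  ext x
  rw [mem_sphereBox, gowersSet, Finset.mem_filter]
  simp only [Finset.mem_univ, true_and, quadForm_eq_bilin]

/-- In characteristic two the form `quadForm A` is linear. -/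
theorem quadForm_sum_of_two {d : ℕ} [Fact (Nat.Prime 2)] {A : Matrix (Fin d) (Fin d) (ZMod 2)}
    (hA : A.IsSymm) {ι : Type*} (t : Finset ι) (b : ι → ZMod 2) (x : ι → Fin d → ZMod 2) :
    quadForm A (∑ i ∈ t, b i • x i) = ∑ i ∈ t, b i * quadForm A (x i) := by
  classical
  have h2 : ∀ c : ZMod 2, c ^ 2 = c := ZMod.pow_card
  have h2' : ∀ c : ZMod 2, c + c = 0 := CharTwo.add_self_eq_zero
  induction t using Finset.induction_on with
  | empty => simp [quadForm]
  | insert i t hi ih =>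
    rw [Finset.sum_insert hi, Finset.sum_insert hi, ← ih]
    simp only [quadForm_eq_bilin, map_add, LinearMap.add_apply, map_smul, LinearMap.smul_apply,
      smul_eq_mul]
    rw [bilin_comm hA (∑ i ∈ t, b i • x i) (x i)]
    linear_combination (bilin A (x i) (x i)) * h2 (b i) +
      h2' (b i * bilin A (x i) (∑ i ∈ t, b i • x i))

variable {m : ℕ} {X : Fin m → Fin d → ZMod p} {I : Finset (Fin m)}

theorem sum_genConst (hI : IsGeneratingSet X I) (j : Fin m) : ∑ i, genConst hI i j = 1 :=
  (existsUnique_genConst hI).exists.choose_spec.1 j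

theorem sum_genConst_smul (hI : IsGeneratingSet X I) (j : Fin m) :
    ∑ i, genConst hI i j • X i = X j :=
  ((existsUnique_genConst hI).exists.choose_spec.2 j).symm

theorem eq_genConst (hI : IsGeneratingSet X I) {b : I → Fin m → ZMod p}
    (h1 : ∀ j, ∑ i, b i j = 1) (h2 : ∀ j, X j = ∑ i, b i j • X i) : b = genConst hI :=
  (existsUnique_genConst hI).unique ⟨h1, h2⟩ (existsUnique_genConst hI).exists.choose_spec

theorem genConst_self (hI : IsGeneratingSet X I) (i i' : I) :
    genConst hI i i' = if i = i' then 1 else 0 := by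
  classical
  have h := eq_genConst hI
    (b := fun i j => if h : j ∈ I then if i = ⟨j, h⟩ then 1 else 0 else genConst hI i j) ?_ ?_
  · have := congr_fun (congr_fun h i) i'
    simp only [Subtype.coe_eta, Finset.coe_mem, dif_pos] at this
    exact this.symm
  · intro j
    by_cases h : j ∈ I
    · simp [h]
    · simpa only [dif_neg h] using sum_genConst hI j
  · intro j
    by_cases h : j ∈ I
    · simp [h, ite_smul]
    · simpa only [dif_neg h] using (sum_genConst_smul hI j).symm

theorem genMap_self (hI : IsGeneratingSet X I) (y : I → Fin d → ZMod p) (i : I) :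
    genMap hI y i = y i := by
  classical
  simp [genMap, genConst_self, ite_smul]

theorem mem_Omega {r : ZMod p} (hI : IsGeneratingSet X I) {x : Fin m → Fin d → ZMod p} :
    x ∈ Omega A r hI ↔ (∀ i : I, quadForm A (x i) = r) ∧
      (∀ i i' : I, quadForm A (x i - x i') = quadForm A (X i - X i')) ∧
      ∀ j, x j = ∑ i, genConst hI i j • x i := by
  rw [Omega, Finset.mem_image]
  constructor
  · rintro ⟨y, hy, rfl⟩
    rw [OmegaSub, Finset.mem_filter] at hy
    simp only [genMap_self]
    exact ⟨hy.2.1, hy.2.2, fun j => rfl⟩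
  · rintro ⟨h1, h2, h3⟩
    refine ⟨fun i => x i, ?_, ?_⟩
    · rw [OmegaSub, Finset.mem_filter]
      exact ⟨Finset.mem_univ _, h1, h2⟩
    · funext j
      exact (h3 j).symm

/-- On an almost congruent copy of a spherical configuration, all inner products are those of the
configuration relative to the centre `z`, up to the common shift `r - ρ`. -/
theorem bilin_of_mem_Omega (hp2 : p ≠ 2) (hA : A.IsSymm) {r ρ : ZMod p} {z : Fin d → ZMod p}
    (hz : ∀ j, quadForm A (X j - z) = ρ) (hI : IsGeneratingSet X I) {x : Fin m → Fin d → ZMod p}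
    (hx : x ∈ Omega A r hI) (j j' : Fin m) :
    bilin A (x j) (x j') = bilin A (X j - z) (X j' - z) + (r - ρ) := by
  rw [mem_Omega] at hx
  obtain ⟨h1, h2, h3⟩ := hx
  simp only [quadForm_eq_bilin] at h1 h2 hz
  have hI' : ∀ i i' : I, bilin A (x i) (x i') = bilin A (X i - z) (X i' - z) + (r - ρ) := by
    intro i i'
    have e1 := h2 i i'
    have e2 : bilin A (X i - X i') (X i - X i') =
        bilin A ((X i - z) - (X i' - z)) ((X i - z) - (X i' - z)) := by
      rw [sub_sub_sub_cancel_right]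
    have hpol : ∀ a b, bilin A (a - b) (a - b) =
        bilin A a a - 2 * bilin A a b + bilin A b b := by
      intro a b
      rw [map_sub, map_sub, LinearMap.sub_apply, LinearMap.sub_apply, bilin_comm hA b a]
      ring
    rw [e2, hpol, hpol, h1, h1, hz, hz] at e1
    apply mul_left_cancel₀ (two_ne_zero_zmod hp2)
    linear_combination -e1
  have hXz : ∀ j, X j - z = ∑ i, genConst hI i j • (X i - z) := by
    intro j
    simp only [smul_sub, Finset.sum_sub_distrib, sum_genConst_smul, ← Finset.sum_smul,
      sum_genConst, one_smul]
  rw [h3 j, h3 j', hXz j, hXz j']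
  simp only [map_sum, map_smul, LinearMap.sum_apply, LinearMap.smul_apply, smul_eq_mul, hI',
    mul_add, Finset.sum_add_distrib, ← Finset.sum_mul, sum_genConst, one_mul]

/-- The points of an almost congruent copy outside the generating set lie on the sphere, too. -/
theorem quadForm_of_mem_Omega (hA : A.IsSymm) {r : ZMod p} (hX : IsSpherical A X)
    (hI : IsGeneratingSet X I) {x : Fin m → Fin d → ZMod p} (hx : x ∈ Omega A r hI) (j : Fin m) :
    quadForm A (x j) = r := by
  by_cases hp2 : p = 2
  · subst hp2
    rw [mem_Omega] at hx
    rw [hx.2.2 j, quadForm_sum_of_two hA]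
    simp only [hx.1, ← Finset.sum_mul, sum_genConst, one_mul]
  · obtain ⟨z, ρ, hz⟩ := hX
    rw [quadForm_eq_bilin, bilin_of_mem_Omega hp2 hA hz hI hx, ← quadForm_eq_bilin, hz]
    ring

/-- An affine frame at the base point `X o`, extracted from the configuration. -/
theorem exists_frame {k : ℕ} (X : Fin m → Fin d → ZMod p) (o : Fin m)
    (hk : Module.finrank (ZMod p) (vectorSpan (ZMod p) (Set.range X)) = k) :
    ∃ (e : Fin k → Fin m) (γ : Fin m → Fin k → ZMod p), Function.Injective e ∧
      LinearIndependent (ZMod p) (fun i => X (e i) - X o) ∧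
      ∀ j, X j - X o = ∑ i, γ j i • (X (e i) - X o) := by
  obtain ⟨κ, a, ha, hspan, hli⟩ := exists_linearIndependent' (ZMod p) (fun j => X j - X o)
  have : Finite κ := Finite.of_injective a ha
  have := Fintype.ofFinite κ
  have hvs : vectorSpan (ZMod p) (Set.range X) =
      Submodule.span (ZMod p) (Set.range fun j => X j - X o) :=
    vectorSpan_range_eq_span_range_vsub_right (ZMod p) X o
  have hcard : Fintype.card κ = k := by
    rw [← hk, hvs, ← hspan, finrank_span_eq_card hli]
  let q := (Fintype.equivFinOfCardEq hcard).symm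
  have hγ : ∀ j, ∃ c : Fin k → ZMod p, ∑ i, c i • (X (a (q i)) - X o) = X j - X o := by
    intro j
    have hj : X j - X o ∈ Submodule.span (ZMod p) (Set.range ((fun j => X j - X o) ∘ a)) := by
      rw [hspan]; exact Submodule.subset_span ⟨j, rfl⟩
    rw [← q.surjective.range_comp] at hj
    exact (Submodule.mem_span_range_iff_exists_fun _).1 hj
  choose γ hγ using hγ
  exact ⟨a ∘ q, γ, ha.comp q.injective, hli.comp q q.injective, fun j => (hγ j).symm⟩

/-- The Gram matrix of `X o - z` and the frame vectors, with its first entry replaced by `r`. -/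
noncomputable def frameGram {k : ℕ} (A : Matrix (Fin d) (Fin d) (ZMod p)) (r : ZMod p)
    (u : Fin (k + 1) → Fin d → ZMod p) : Fin (k + 1) → Fin (k + 1) → ZMod p :=
  fun i j => bilin A (u i) (u j) + if i = 0 ∧ j = 0 then r - bilin A (u 0) (u 0) else 0

/-- The configuration with base point `T 0` and frame vectors `T 1, …, T k`. -/
def framePt {k : ℕ} (γ : Fin m → Fin k → ZMod p) (T : Fin (k + 1) → Fin d → ZMod p) :
    Fin m → Fin d → ZMod p :=
  fun j => T 0 + ∑ i, γ j i • T i.succ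

theorem bilin_framePt {k : ℕ} (γ : Fin m → Fin k → ZMod p) {r : ZMod p}
    {u T : Fin (k + 1) → Fin d → ZMod p} (hT : T ∈ gramSet (bilin A) (frameGram A r u))
    (j j' : Fin m) : bilin A (framePt γ T j) (framePt γ T j') =
      bilin A (framePt γ u j) (framePt γ u j') + (r - bilin A (u 0) (u 0)) := by
  rw [mem_gramSet] at hT
  simp only [frameGram] at hT
  simp only [framePt, map_add, map_sum, map_smul, LinearMap.add_apply, LinearMap.sum_apply,
    LinearMap.smul_apply, smul_eq_mul, hT, Fin.succ_ne_zero, and_true, and_false,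
    if_false, if_true, add_zero]
  ring

end

section

variable {p d : ℕ} [Fact p.Prime] {A : Matrix (Fin d) (Fin d) (ZMod p)}

/-- The almost congruent copies of a spherical configuration are exactly the configurations whose
base point and frame vectors have the Gram matrix `frameGram`. -/
theorem expect_Omega_eq {m : ℕ} {X : Fin m → Fin d → ZMod p} {I : Finset (Fin m)} (hp2 : p ≠ 2)
    (hA : A.IsSymm) (r : ZMod p) {ρ : ZMod p} {z : Fin d → ZMod p}
    (hz : ∀ j, quadForm A (X j - z) = ρ) (hI : IsGeneratingSet X I) (o : Fin m) {k : ℕ}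
    (e : Fin k → Fin m) (γ : Fin m → Fin k → ZMod p)
    (hli : LinearIndependent (ZMod p) fun i => X (e i) - X o)
    (hγ : ∀ j, X j - X o = ∑ i, γ j i • (X (e i) - X o)) (F : (Fin m → Fin d → ZMod p) → ℂ) :
    (Omega A r hI).expect F =
      (gramSet (bilin A) (frameGram A r (Fin.cons (X o - z) fun i => X (e i) - X o))).expect
        fun T => F (framePt γ T) := by
  set u : Fin (k + 1) → Fin d → ZMod p := Fin.cons (X o - z) fun i => X (e i) - X o with hu
  have hu0 : bilin A (u 0) (u 0) = ρ := by
    rw [hu, Fin.cons_zero, ← quadForm_eq_bilin, hz]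
  have huX : ∀ j, framePt γ u j = X j - z := by
    intro j
    simp only [framePt, hu, Fin.cons_zero, Fin.cons_succ, ← hγ]
    abel
  have huniq : ∀ c c' : Fin k → ZMod p,
      ∑ i, c i • (X (e i) - X o) = ∑ i, c' i • (X (e i) - X o) → c = c' := by
    intro c c' h
    funext i
    rw [← sub_eq_zero]
    refine Fintype.linearIndependent_iff.1 hli (fun i => c i - c' i) ?_ i
    simp only [sub_smul, Finset.sum_sub_distrib, h, sub_self]
  have hγo : γ o = 0 := huniq _ _ (by rw [← hγ]; simp)
  have hγe : ∀ i, γ (e i) = Pi.single i 1 := fun i => huniq _ _ (by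
    rw [← hγ, Finset.sum_eq_single i] <;> simp +contextual)
  have hfo : ∀ T : Fin (k + 1) → Fin d → ZMod p, framePt γ T o = T 0 := by
    intro T; simp [framePt, hγo]
  have hfe : ∀ (T : Fin (k + 1) → Fin d → ZMod p) i, framePt γ T (e i) = T 0 + T i.succ := by
    intro T i
    rw [framePt, hγe, Finset.sum_eq_single i] <;> simp +contextual
  -- The same affine relations hold for the generating set and for the frame.
  have hgenγ : ∀ j, ∑ i : I, genConst hI i j • γ i = γ j := by
    intro j
    refine huniq _ _ ?_
    rw [← hγ]
    simp only [Finset.sum_apply, Pi.smul_apply, smul_eq_mul, Finset.sum_smul, mul_smul]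
    rw [Finset.sum_comm]
    simp only [← Finset.smul_sum, ← hγ]
    simp only [smul_sub, Finset.sum_sub_distrib, sum_genConst_smul, ← Finset.sum_smul,
      sum_genConst, one_smul]
  have hγgen : (fun (i : I) j => genConst hI i o +
      ∑ l, γ j l * (genConst hI i (e l) - genConst hI i o)) = genConst hI := by
    refine eq_genConst hI (fun j => ?_) fun j => ?_
    · rw [Finset.sum_add_distrib, Finset.sum_comm, sum_genConst]
      simp only [← Finset.mul_sum, Finset.sum_sub_distrib, sum_genConst, sub_self, mul_zero,
        Finset.sum_const_zero, add_zero]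
    · simp only [add_smul, Finset.sum_add_distrib, sum_genConst_smul, Finset.sum_smul, mul_smul]
      rw [Finset.sum_comm]
      simp only [← Finset.smul_sum, sub_smul, Finset.sum_sub_distrib, sum_genConst_smul, ← hγ]
      abel
  refine Finset.expect_nbij' (fun x => Fin.cons (x o) fun i => x (e i) - x o)
    (fun T => framePt γ T) ?_ ?_ ?_ ?_ ?_
  · intro x hx
    have hH := bilin_of_mem_Omega hp2 hA hz hI hx
    simp only [← huX] at hH
    rw [mem_gramSet]
    intro i j
    simp only [frameGram, hu0]
    refine Fin.cases ?_ (fun i => ?_) i <;> refine Fin.cases ?_ (fun j => ?_) j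
    · simp [hH, hfo]
    · simp [hH, hfo, hfe]
    · simp [hH, hfo, hfe]
    · simp only [Fin.cons_succ, map_sub, LinearMap.sub_apply, hH, hfo, hfe, map_add,
        LinearMap.add_apply, Fin.succ_ne_zero, and_self, if_false]
      ring
  · intro T hT
    have hH := bilin_framePt γ hT
    simp only [hu0, huX] at hH
    have hM : ∀ j, quadForm A (framePt γ T j) = r := by
      intro j
      rw [quadForm_eq_bilin, hH, ← quadForm_eq_bilin, hz]; ring
    rw [mem_Omega]
    refine ⟨fun i => hM i, fun i i' => ?_, fun j => ?_⟩
    · rw [← sub_sub_sub_cancel_right (X i) (X i') z]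
      simp only [quadForm_eq_bilin, map_sub _ (framePt γ T _) (framePt γ T _),
        map_sub _ (X _ - z) (X _ - z), LinearMap.sub_apply, hH]
      ring
    · simp only [framePt, smul_add, Finset.sum_add_distrib, ← Finset.sum_smul, sum_genConst,
        one_smul, add_right_inj]
      rw [← hgenγ j]
      simp only [Finset.sum_apply, Pi.smul_apply, smul_eq_mul, Finset.sum_smul, mul_smul,
        Finset.smul_sum]
      rw [Finset.sum_comm]
  · intro x hx
    have hx' := (mem_Omega hI).1 hx
    funext j
    simp only [framePt, Fin.cons_zero, Fin.cons_succ]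
    have h3 := hx'.2.2
    rw [h3 j, ← hγgen]
    simp only [add_smul, Finset.sum_add_distrib, ← h3 o, Finset.sum_smul, mul_smul]
    rw [Finset.sum_comm]
    simp only [← Finset.smul_sum, sub_smul, Finset.sum_sub_distrib, ← h3]
  · intro T hT
    funext i
    refine Fin.cases ?_ (fun i => ?_) i
    · simp [hfo]
    · simp [hfo, hfe]
  · intro x hx
    have hx' := (mem_Omega hI).1 hx
    congr 1
    funext j
    simp only [framePt, Fin.cons_zero, Fin.cons_succ]
    have h3 := hx'.2.2
    rw [h3 j, ← hγgen]
    simp only [add_smul, Finset.sum_add_distrib, ← h3 o, Finset.sum_smul, mul_smul]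
    rw [Finset.sum_comm (s := Finset.univ (α := I))]
    simp only [← Finset.smul_sum, sub_smul, Finset.sum_sub_distrib, ← h3]

/-! ### Directions and classes -/

/-- The points other than the base point fall into `s` classes, each of which is fixed by moving
the base point and the frame in a suitable direction `φ b`: the frame points form one class, and
each of the remaining `s - 1` points is a class of its own. -/
theorem exists_directions {k s : ℕ} (hs : 1 ≤ s) (X : Fin (k + s) → Fin d → ZMod p)
    (hX : Function.Injective X) (o : Fin (k + s)) (e : Fin k → Fin (k + s))
    (γ : Fin (k + s) → Fin k → ZMod p) (he : Function.Injective e)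
    (hli : LinearIndependent (ZMod p) fun i => X (e i) - X o)
    (hγ : ∀ j, X j - X o = ∑ i, γ j i • (X (e i) - X o)) :
    ∃ (cl : Fin (k + s) → ℕ) (φ : ℕ → Fin (k + 1) → ZMod p), (∀ j, cl j < s) ∧
      (∀ b, φ b 0 = 1) ∧ ∀ j, j ≠ o → 1 + ∑ i, γ j i * φ (cl j) i.succ = 0 := by
  classical
  have heo : ∀ i, e i ≠ o := by
    intro i h
    exact hli.ne_zero i (by simp [h])
  have hγe : ∀ i, γ (e i) = Pi.single i 1 := by
    intro i
    funext l
    rw [← sub_eq_zero]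
    refine Fintype.linearIndependent_iff.1 hli (fun l => γ (e i) l - (Pi.single i 1 : Fin k → ZMod p) l) ?_ l
    simp only [sub_smul, Finset.sum_sub_distrib, ← hγ]
    rw [Finset.sum_eq_single i] <;> simp +contextual
  let R : Finset (Fin (k + s)) := (insert o (Finset.univ.image e))ᶜ
  have hR : R.card = s - 1 := by
    rw [Finset.card_compl, Finset.card_insert_of_notMem (by simpa using heo),
      Finset.card_image_of_injective _ he, Finset.card_univ, Fintype.card_fin, Fintype.card_fin]
    omega
  let q := R.equivFin
  let cl : Fin (k + s) → ℕ := fun j => if h : j ∈ R then (q ⟨j, h⟩ : ℕ) + 1 else 0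
  have hφ : ∀ b : ℕ, ∃ φ : Fin (k + 1) → ZMod p, φ 0 = 1 ∧
      ∀ j, j ≠ o → cl j = b → 1 + ∑ i, γ j i * φ i.succ = 0 := by
    intro b
    by_cases hb : ∃ j, ∃ h : j ∈ R, (q ⟨j, h⟩ : ℕ) + 1 = b
    · obtain ⟨j₀, h₀, hb⟩ := hb
      have hj₀ : j₀ ≠ o := by
        rintro rfl
        simp [R] at h₀
      obtain ⟨l, hl⟩ : ∃ l, γ j₀ l ≠ 0 := by
        by_contra! h
        refine hj₀ (hX (sub_eq_zero.1 ?_))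
        rw [hγ]
        simp [h]
      -- `X j₀ ≠ X o` has a nonzero frame coordinate `l`, which can cancel the base point.
      refine ⟨Fin.cons 1 (Pi.single l (-(γ j₀ l)⁻¹)), Fin.cons_zero _ _, fun j _ hcl => ?_⟩
      have hj : j = j₀ := by
        by_cases h : j ∈ R
        · simp only [cl, dif_pos h] at hcl
          have : q ⟨j, h⟩ = q ⟨j₀, h₀⟩ := Fin.ext (by omega)
          exact congrArg Subtype.val (q.injective this)
        · simp only [cl, dif_neg h] at hcl
          omega
      subst hj
      simp only [Fin.cons_succ]
      rw [Finset.sum_eq_single l (fun i _ hi => by simp [hi]) (by simp)]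
      simp [hl]
    · refine ⟨Fin.cons 1 fun _ => -1, Fin.cons_zero _ _, fun j hj hcl => ?_⟩
      have hjR : j ∉ R := fun h => hb ⟨j, h, by simpa only [cl, dif_pos h] using hcl⟩
      obtain ⟨i, rfl⟩ : ∃ i, e i = j := by
        simpa [R, hj] using hjR
      simp [hγe]
  choose φ hφ0 hφ using hφ
  refine ⟨cl, φ, fun j => ?_, hφ0, fun j hj => hφ _ j hj rfl⟩
  by_cases h : j ∈ R
  · have := (q ⟨j, h⟩).isLt
    simp only [cl, dif_pos h]
    omega
  · simp only [cl, dif_neg h]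
    omega

theorem norm_expect_le_one {α : Type*} (S : Finset α) (F : α → ℂ) (hF : ∀ x ∈ S, ‖F x‖ ≤ 1) :
    ‖S.expect F‖ ≤ 1 := by
  rw [Finset.expect_eq_sum_div_card, norm_div, RCLike.norm_natCast]
  refine div_le_one_of_le₀ ?_ (Nat.cast_nonneg _)
  refine (norm_sum_le_of_le _ hF).trans ?_
  simp

/-- The inequality before taking `2 ^ s`-th roots, for odd `p` and any distinguished point `o`. -/
theorem norm_expect_Omega_pow_le (s : ℕ) (hs : 1 ≤ s) : ∃ K : ℝ, 0 ≤ K ∧ ∀ (k d p : ℕ)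
    [Fact p.Prime], p ≠ 2 → (k + s + 2) * (k + s + 1) + 1 ≤ d →
      ∀ A : Matrix (Fin d) (Fin d) (ZMod p), A.IsSymm → A.det ≠ 0 →
      ∀ (r : ZMod p) (X : Fin (k + s) → Fin d → ZMod p), Function.Injective X →
        Module.finrank (ZMod p) (vectorSpan (ZMod p) (Set.range X)) = k →
        IsSpherical A X →
      ∀ (I : Finset (Fin (k + s))) (hI : IsGeneratingSet X I) (o : Fin (k + s))
        (f : Fin (k + s) → (Fin d → ZMod p) → ℂ),
        (∀ j x, quadForm A x = r → ‖f j x‖ ≤ 1) →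
        ‖Finset.expect (Omega A r hI) fun x => ∏ j, f j (x j)‖ ^ 2 ^ s
          ≤ ‖Finset.expect (gowersSet A r s) fun nh =>
      ∏ ε : Finset (Fin s), (starRingEnd ℂ)^[ε.card] (f o (nh.1 + ∑ i ∈ ε, nh.2 i))‖ +
        K * (1 / √p) := by
  obtain ⟨K, hK, key⟩ := norm_expect_gramSet_pow_le s
  refine ⟨K, hK, ?_⟩
  intro k d p _ hp2 hd A hA hdet r X hX hk hsph I hI o f hf
  obtain ⟨e, γ, he, hli, hγ⟩ := exists_frame X o hk
  obtain ⟨cl, φ, hcl, hφ, hdir⟩ := exists_directions hs X hX o e γ he hli hγ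
  obtain ⟨z, ρ, hz⟩ := hsph
  rw [expect_Omega_eq hp2 hA r hz hI o e γ hli hγ, gowersSet_eq_sphereBox]
  set u : Fin (k + 1) → Fin d → ZMod p := Fin.cons (X o - z) fun i => X (e i) - X o with hu
  have hu0 : bilin A (u 0) (u 0) = ρ := by
    rw [hu, Fin.cons_zero, ← quadForm_eq_bilin, hz]
  have huX : ∀ j, framePt γ u j = X j - z := by
    intro j
    simp only [framePt, hu, Fin.cons_zero, Fin.cons_succ, ← hγ]
    abel
  have hγo : γ o = 0 := by
    funext i
    exact Fintype.linearIndependent_iff.1 hli (γ o) (by rw [← hγ, sub_self]) i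
  have hG00 : frameGram A r u 0 0 = r := by simp [frameGram]
  have hsphere : ∀ T ∈ gramSet (bilin A) (frameGram A r u), ∀ j,
      quadForm A (framePt γ T j) = r := by
    intro T hT j
    rw [quadForm_eq_bilin, bilin_framePt γ hT, hu0, huX, ← quadForm_eq_bilin, hz]
    ring
  have hmain := key (d := d) hp2 (by simp [ZMod.card]) (bilin A) (bilin_comm hA)
    (bilin_nondegenerate hdet) (frameGram A r u)
    (fun i j => by simp only [frameGram, bilin_comm hA (u i) (u j), and_comm]) φ hφ
    (by rw [two_mul_eqCount]; exact hd)
    (fun b T => ∏ j ∈ (Finset.univ.erase o).filter (fun j => cl j = b), f j (framePt γ T j))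
    (f o) ?_ ?_ ?_
  · rw [hG00] at hmain
    refine le_trans (le_of_eq ?_) hmain
    congr 2
    refine Finset.expect_congr rfl fun T _ => ?_
    rw [Finset.prod_fiberwise_of_maps_to (fun j _ => Finset.mem_range.2 (hcl j)),
      mul_comm, ← Finset.mul_prod_erase _ _ (Finset.mem_univ o)]
    congr 2
    simp [framePt, hγo]
  · intro b T v
    refine Finset.prod_congr rfl fun j hj => ?_
    simp only [Finset.mem_filter, Finset.mem_erase, Finset.mem_univ, and_true] at hj
    congr 1
    have h := hdir j hj.1
    rw [hj.2] at h
    simp only [framePt, hφ, one_smul, smul_add, Finset.sum_add_distrib, smul_smul,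
      ← Finset.sum_smul]
    rw [eq_neg_of_add_eq_zero_right h]
    simp only [neg_smul, one_smul]
    abel
  · intro b T hT
    rw [norm_prod]
    exact Finset.prod_le_one (fun _ _ => norm_nonneg _) fun j _ => hf j _ (hsphere T hT j)
  · intro x hx
    rw [hG00, ← quadForm_eq_bilin] at hx
    exact hf o x hx

end

end SphericalGowers

open SphericalGowers in
theorem theorem4p2 (s : ℕ) (hs : 1 ≤ s) :
    ∃ c : ℝ, 0 < c ∧ ∀ k : ℕ, ∃ C : ℝ, 0 < C ∧
      ∀ (d p : ℕ) [Fact p.Prime], (k + s + 2) * (k + s + 1) + 1 ≤ d →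
      ∀ A : Matrix (Fin d) (Fin d) (ZMod p), A.IsSymm → A.det ≠ 0 →
      ∀ (r : ZMod p) (X : Fin (k + s) → Fin d → ZMod p), Function.Injective X →
        Module.finrank (ZMod p) (vectorSpan (ZMod p) (Set.range X)) = k →
        IsSpherical A X →
      ∀ (I : Finset (Fin (k + s))) (hI : IsGeneratingSet X I)
        (f : Fin (k + s) → (Fin d → ZMod p) → ℂ),
        (∀ j x, quadForm A x = r → ‖f j x‖ ≤ 1) →
        ‖Finset.expect (Omega A r hI) fun x => ∏ j, f j (x j)‖
          ≤ gowersNorm A r s (f ⟨0, by omega⟩) + C * (p : ℝ) ^ (-c) := by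
  obtain ⟨K, hK, key⟩ := norm_expect_Omega_pow_le s hs
  set α : ℝ := 1 / 2 ^ s with hα
  have hα0 : 0 < α := by positivity
  have hα1 : α ≤ 1 := by
    rw [hα, div_le_one (by positivity)]
    exact one_le_pow₀ (by norm_num)
  refine ⟨α / 2, by positivity, fun k => ⟨K ^ α + 2, by positivity, ?_⟩⟩
  intro d p _ hd A hA hdet r X hX hk hsph I hI f hf
  have hp : (0 : ℝ) < p := by exact_mod_cast (Fact.out : p.Prime).pos
  by_cases hp2 : p = 2
  · -- For `p = 2` the left-hand side is at most one.
    have h1 : ‖Finset.expect (Omega A r hI) fun x => ∏ j, f j (x j)‖ ≤ 1 := by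
      refine norm_expect_le_one _ _ fun x hx => ?_
      rw [norm_prod]
      exact Finset.prod_le_one (fun _ _ => norm_nonneg _) fun j _ =>
        hf j _ (quadForm_of_mem_Omega hA hsph hI hx j)
    -- The summand `2` of the constant absorbs this, as `2 * 2 ^ (-α / 2) ≥ 1`.
    have h2 : 0 ≤ gowersNorm A r s (f ⟨0, by omega⟩) := by
      unfold gowersNorm; positivity
    have h3 : (1 : ℝ) ≤ (K ^ α + 2) * (p : ℝ) ^ (-(α / 2)) := by
      have h4 : (2 : ℝ)⁻¹ ≤ (p : ℝ) ^ (-(α / 2)) := by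
        rw [hp2, ← Real.rpow_neg_one]
        push_cast
        exact Real.rpow_le_rpow_of_exponent_le (by norm_num) (by linarith)
      have h5 : 0 ≤ K ^ α := by positivity
      nlinarith
    linarith
  · have h := key k d p hp2 hd A hA hdet r X hX hk hsph I hI ⟨0, by omega⟩ f hf
    rw [gowersNorm, ← hα]
    set g : ℝ := ‖Finset.expect (gowersSet A r s) fun nh =>
      ∏ ε : Finset (Fin s), (starRingEnd ℂ)^[ε.card]
        (f ⟨0, by omega⟩ (nh.1 + ∑ i ∈ ε, nh.2 i))‖ with hg
    have hg0 : 0 ≤ g := norm_nonneg _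
    have h1 : ‖Finset.expect (Omega A r hI) fun x => ∏ j, f j (x j)‖ ≤
        (g + K * (1 / √p)) ^ α := by
      have h2 := Real.rpow_le_rpow (by positivity) h hα0.le
      rwa [← Real.rpow_natCast, ← Real.rpow_mul (norm_nonneg _), hα, Nat.cast_pow, Nat.cast_ofNat,
        mul_one_div_cancel (by positivity), Real.rpow_one] at h2
    have h2 : (g + K * (1 / √p)) ^ α ≤ g ^ α + (K * (1 / √p)) ^ α :=
      Real.rpow_add_le_add_rpow hg0 (by positivity) hα0.le hα1
    have h3 : (K * (1 / √(p : ℝ))) ^ α = K ^ α * (p : ℝ) ^ (-(α / 2)) := by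
      rw [Real.mul_rpow hK (by positivity), one_div, Real.sqrt_eq_rpow, ← Real.rpow_neg hp.le,
        ← Real.rpow_mul hp.le]
      congr 2
      ring
    have h4 : 0 ≤ (p : ℝ) ^ (-(α / 2)) := by positivity
    linarith
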